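/- Let $d\ge 1$ and $\beta\in\mathbb R$. Let $\dot{\mathcal S}(\mathbb R^d)$ be the space of Schwartz functions $\psi$ with $D^\alpha\widehat\psi(0)=0$ for all multi-indices $\alpha$, with the topology of $\mathcal S(\mathbb R^d)$, and let $\dot{\mathcal S}'(\mathbb R^d)$ be its dual (tempered distributions modulo polynomials). Fix a real-valued radial $\varphi\in C_c^\infty(\mathbb R^d)$ with $\operatorname{supp}\varphi\subset\{3/4<|\xi|<7/4\}$, $\varphi=1$ on $\{7/8<|\xi|<9/8\}$ and $\sum_{j\in\mathbb Z}\varphi(2^{-j}\xi)=1$ for $\xi\ne0$, and put $\widehat{\dot\Delta_jf}(\xi)=\varphi(2^{-j}\xi)\widehat f(\xi)$. Let $\Pi$ satisfy: (a) $\Pi:[0,\infty)\to(0,\infty)$ is non-decreasing; (b) $\Pi$ is doubling: $\Pi(2t)\le A\,\Pi(t)$ for all $t\ge0$ and some constant $A$; (c) for some constant $D$, $\sum_{j=N}^\infty2^{-j}\Pi(j)\le D\,2^{-N}\Pi(N)$ for all integers $N\ge0$. For $f\in\dot{\mathcal S}'(\mathbb R^d)$ and $s\in\mathbb R$ let $$\|f\|_{\dot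 B^{s}_{\infty,1}}=\sum_{j\in\mathbb Z}2^{js}\|\dot\Delta_jf\|_{L^\infty},\qquad \|f\|_{\dot B^{\beta}_{\Pi}}=\sup_{N\ge0}\frac1{\Pi(N)}\sum_{j=-\infty}^N2^{j\beta}\|\dot\Delta_jf\|_{L^\infty},$$ $\|f\|_{\dot B^\beta_\Pi\cap\dot B^{\beta-1}_{\infty,1}}=\max\{\|f\|_{\dot B^\beta_\Pi},\|f\|_{\dot B^{\beta-1}_{\infty,1}}\}$, and let $y_\Pi(r)=\inf_{p>1}\Pi(p)\,r^{1/p}$ for $r>0$. Let $R=(R_1,\dots,R_d)$ be a Riesz-type transform, i.e. each $R_l$ is a Fourier multiplier whose symbol is homogeneous of degree $0$ and $C^\infty$ on $\mathbb R^d\setminus\{0\}$. (For $d=2$ and $R=\nabla^\perp(-\Delta)^{-1/2}$ one gets the generalized SQG equations.) Consider the Biot-Savart law $v=R(-\Delta)^{\frac{\beta-1}2}\omega$ of the active scalar equation $\omega_t+v\cdot\nabla\omega=0$ on $\mathbb R^d$ at a fixed time, as an identity in $\dot{\mathcal S}'(\mathbb R^d)$. Then there is a constant $C$, depending only on $d,\beta,\varphi,R,\Pi$,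 such that for every $\omega\in\dot B^\beta_\Pi(\mathbb R^d)\cap\dot B^{\beta-1}_{\infty,1}(\mathbb R^d)$ the velocity $v=R(-\Delta)^{\frac{\beta-1}2}\omega\in\dot{\mathcal S}'(\mathbb R^d)^d$ is represented by a bounded continuous vector field, and every bounded continuous vector field, again denoted by $v$, that represents it satisfies $$|v(x)-v(y)|\le C\,|x-y|\;y_\Pi\Big(\frac1{|x-y|}\Big)\,\|\omega\|_{\dot B^\beta_\Pi\cap\dot B^{\beta-1}_{\infty,1}}\qquad\text{for all }x\ne y.$$ -/

import Mathlib

open MeasureTheory SchwartzMap FourierTransform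
open scoped ENNReal ContDiff BoundedContinuousFunction

noncomputable section

/-- The Euclidean space `ℝ^d`. -/
abbrev Rd (d : ℕ) := EuclideanSpace ℝ (Fin d)

/-! ### Growth functions and Yudovich functions -/

/-- Admissible growth functions with parameter `κ`: positive and non-decreasing on `[0, ∞)`,
doubling, and with `∑_{j ≥ N} 2^{-jκ} G(j) ≲ 2^{-Nκ} G(N)` for all integers `N ≥ 0`. -/
structure IsGrowth (κ : ℝ) (G : ℝ → ℝ) : Prop where
  pos : ∀ t, 0 ≤ t → 0 < G t
  mono : ∀ s t, 0 ≤ s → s ≤ t → G s ≤ G t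
  doubling : ∃ A : ℝ, ∀ t, 0 ≤ t → G (2 * t) ≤ A * G t
  tail : ∃ D : ℝ, ∀ N : ℕ,
    Summable (fun k : ℕ => (2 : ℝ) ^ (-((N + k : ℕ) : ℝ) * κ) * G ((N + k : ℕ) : ℝ)) ∧
      ∑' k : ℕ, (2 : ℝ) ^ (-((N + k : ℕ) : ℝ) * κ) * G ((N + k : ℕ) : ℝ)
        ≤ D * ((2 : ℝ) ^ (-(N : ℝ) * κ) * G (N : ℝ))

/-- The Yudovich function `y_G(r) = inf_{p > 1} G(p) r^{1/p}`. -/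
def yudovich (G : ℝ → ℝ) (r : ℝ) : ℝ := ⨅ p : Set.Ioi (1 : ℝ), G p * r ^ (1 / (p : ℝ))

/-! ### Schwartz functions all of whose moments vanish, and their dual -/

/-- The space of Schwartz functions whose Fourier transform vanishes at the origin together with
all its derivatives, with the topology inherited from the Schwartz space. -/
def Sdot (d : ℕ) : Submodule ℂ 𝓢(Rd d, ℂ) where
  carrier := {ψ | ∀ n : ℕ, iteratedFDeriv ℝ n (𝓕 ψ : 𝓢(Rd d, ℂ)) 0 = 0}
  zero_mem' n := by
    have h : ((𝓕 (0 : 𝓢(Rd d, ℂ)) : 𝓢(Rd d, ℂ)) : Rd d → ℂ) = fun _ => 0 := by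
      have : (𝓕 (0 : 𝓢(Rd d, ℂ)) : 𝓢(Rd d, ℂ)) = 0 := map_zero (fourierCLM ℂ 𝓢(Rd d, ℂ))
      rw [this]; rfl
    rw [h, iteratedFDeriv_fun_zero]; rfl
  add_mem' {a b} ha hb n := by
    have h : (𝓕 (a + b) : 𝓢(Rd d, ℂ)) = 𝓕 a + 𝓕 b := map_add (fourierCLM ℂ 𝓢(Rd d, ℂ)) a b
    have h' : ((𝓕 (a + b) : 𝓢(Rd d, ℂ)) : Rd d → ℂ)
        = ((𝓕 a : 𝓢(Rd d, ℂ)) : Rd d → ℂ) + ((𝓕 b : 𝓢(Rd d, ℂ)) : Rd d → ℂ) := by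
      rw [h]; rfl
    rw [h', iteratedFDeriv_add_apply ((𝓕 a : 𝓢(Rd d, ℂ)).smooth n).contDiffAt
      ((𝓕 b : 𝓢(Rd d, ℂ)).smooth n).contDiffAt, ha n, hb n, add_zero]
  smul_mem' c a ha n := by
    have h : (𝓕 (c • a) : 𝓢(Rd d, ℂ)) = c • 𝓕 a := map_smul (fourierCLM ℂ 𝓢(Rd d, ℂ)) c a
    have h' : ((𝓕 (c • a) : 𝓢(Rd d, ℂ)) : Rd d → ℂ)
        = c • ((𝓕 a : 𝓢(Rd d, ℂ)) : Rd d → ℂ) := by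
      rw [h]; rfl
    rw [h', iteratedFDeriv_const_smul_apply ((𝓕 a : 𝓢(Rd d, ℂ)).smooth n).contDiffAt, ha n,
      smul_zero]

/-- The dual of `Sdot d`, i.e. tempered distributions modulo polynomials. -/
abbrev SdotDual (d : ℕ) := Sdot d →L[ℂ] ℂ

/-! ### Littlewood-Paley decomposition -/

/-- A generator of a homogeneous dyadic partition of unity on `ℝ^d`. -/
structure LittlewoodPaley (d : ℕ) where
  toFun : Rd d → ℝ
  smooth : ContDiff ℝ ∞ toFun
  compact : HasCompactSupport toFun
  radial : ∀ ξ η : Rd d, ‖ξ‖ = ‖η‖ → toFun ξ = toFun η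
  support : tsupport toFun ⊆ {ξ | 3 / 4 < ‖ξ‖ ∧ ‖ξ‖ < 7 / 4}
  eq_one : ∀ ξ : Rd d, 7 / 8 < ‖ξ‖ → ‖ξ‖ < 9 / 8 → toFun ξ = 1
  sum_eq_one : ∀ ξ : Rd d, ξ ≠ 0 → HasSum (fun j : ℤ => toFun ((2 : ℝ) ^ (-j) • ξ)) 1

namespace LittlewoodPaley

variable {d : ℕ}

/-- The symbol `φ(2^{-j} ξ)` of the `j`-th dyadic block. -/
def symbol (φ : LittlewoodPaley d) (j : ℤ) (ξ : Rd d) : ℂ := (φ.toFun ((2 : ℝ) ^ (-j) • ξ) : ℂ)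

theorem symbol_hasTemperateGrowth (φ : LittlewoodPaley d) (j : ℤ) :
    (φ.symbol j).HasTemperateGrowth := by
  have h2 : (2 : ℝ) ^ (-j) ≠ 0 := by positivity
  have hc : HasCompactSupport (φ.symbol j) :=
    (φ.compact.comp_homeomorph (Homeomorph.smulOfNeZero _ h2)).comp_left
      (g := fun x : ℝ => (x : ℂ)) Complex.ofReal_zero
  have hs : ContDiff ℝ ∞ (φ.symbol j) :=
    Complex.ofRealCLM.contDiff.comp (φ.smooth.comp (contDiff_const_smul _))
  exact (hc.toSchwartzMap hs).hasTemperateGrowth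

theorem symbol_eventually_zero (φ : LittlewoodPaley d) (j : ℤ) :
    ∀ᶠ ξ in nhds (0 : Rd d), φ.symbol j ξ = 0 := by
  have h0 : (0 : Rd d) ∉ tsupport φ.toFun := fun h => by
    have := (φ.support h).1
    rw [norm_zero] at this
    norm_num at this
  have h1 : ∀ᶠ ξ in nhds (0 : Rd d), φ.toFun ξ = 0 :=
    notMem_tsupport_iff_eventuallyEq.1 h0
  have h2 : Filter.Tendsto (fun ξ : Rd d => (2 : ℝ) ^ (-j) • ξ) (nhds 0) (nhds 0) := by
    have : Continuous fun ξ : Rd d => (2 : ℝ) ^ (-j) • ξ := continuous_const_smul _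
    simpa using this.tendsto 0
  filter_upwards [h2.eventually h1] with ξ hξ
  simp only [symbol, hξ, Complex.ofReal_zero]

theorem block_mem (φ : LittlewoodPaley d) (j : ℤ) (ψ : 𝓢(Rd d, ℂ)) :
    ((fourierCLM ℂ 𝓢(Rd d, ℂ)) ∘L (smulLeftCLM ℂ (φ.symbol j)) ∘L
      (fourierInvCLM ℂ 𝓢(Rd d, ℂ))) ψ ∈ Sdot d := by
  intro n
  set h : 𝓢(Rd d, ℂ) := smulLeftCLM ℂ (φ.symbol j) (𝓕⁻ ψ) with hh
  change iteratedFDeriv ℝ n ((𝓕 (𝓕 h : 𝓢(Rd d, ℂ)) : 𝓢(Rd d, ℂ)) : Rd d → ℂ) 0 = 0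
  have key : ((𝓕 (𝓕 h : 𝓢(Rd d, ℂ)) : 𝓢(Rd d, ℂ)) : Rd d → ℂ) =ᶠ[nhds 0] fun _ => (0 : ℂ) := by
    have hneg : Filter.Tendsto (fun ξ : Rd d => -ξ) (nhds 0) (nhds 0) := by
      simpa using (continuous_neg (G := Rd d)).tendsto 0
    filter_upwards [hneg.eventually (φ.symbol_eventually_zero j)] with ξ hξ
    have e1 : (𝓕 (𝓕 h : 𝓢(Rd d, ℂ)) : 𝓢(Rd d, ℂ)) ξ
        = (𝓕⁻ (𝓕 h : 𝓢(Rd d, ℂ)) : 𝓢(Rd d, ℂ)) (-ξ) := by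
      rw [fourier_coe, fourierInv_coe, Real.fourierInv_eq_fourier_neg, neg_neg]
    rw [e1, fourierInv_fourier_eq, hh,
      smulLeftCLM_apply_apply (φ.symbol_hasTemperateGrowth j), hξ, zero_smul]
  rw [(key.iteratedFDeriv ℝ n).eq_of_nhds, iteratedFDeriv_fun_zero]
  rfl

/-- The transpose of the `j`-th dyadic block, `ψ ↦ 𝓕(φ(2^{-j} ·) 𝓕⁻ ψ)`, as a map from
Schwartz functions to `Sdot d`. -/
def blockTranspose (φ : LittlewoodPaley d) (j : ℤ) : 𝓢(Rd d, ℂ) →L[ℂ] Sdot d :=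
  ((fourierCLM ℂ 𝓢(Rd d, ℂ)) ∘L (smulLeftCLM ℂ (φ.symbol j)) ∘L
    (fourierInvCLM ℂ 𝓢(Rd d, ℂ))).codRestrict (Sdot d) (φ.block_mem j)

/-- The `j`-th dyadic block of `f`, a tempered distribution: its Fourier transform is
`φ(2^{-j} ·)` times that of `f`. -/
def block (φ : LittlewoodPaley d) (j : ℤ) (f : SdotDual d) : 𝓢'(Rd d, ℂ) :=
  ContinuousLinearMap.toPointwiseConvergenceCLM _ _ _ _ (f ∘L φ.blockTranspose j)

end LittlewoodPaley

/-! ### Besov and Vishik norms -/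

/-- The `L^∞` norm of a tempered distribution (`∞` if it is not given by an `L^∞` function). -/
def linftyNorm {d : ℕ} (u : 𝓢'(Rd d, ℂ)) : ℝ≥0∞ :=
  ⨅ (F : Lp ℂ ∞ (volume : Measure (Rd d))) (_ : (F : 𝓢'(Rd d, ℂ)) = u), ‖F‖ₑ

/-- The norm of the homogeneous Besov space with smoothness `s` and indices `∞, 1`. -/
def besovNorm {d : ℕ} (φ : LittlewoodPaley d) (s : ℝ) (f : SdotDual d) : ℝ≥0∞ :=
  ∑' j : ℤ, (2 : ℝ≥0∞) ^ ((j : ℝ) * s) * linftyNorm (φ.block j f)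

/-- The norm of the homogeneous Vishik space with smoothness `β` and growth function `G`. -/
def vishikNorm {d : ℕ} (φ : LittlewoodPaley d) (β : ℝ) (G : ℝ → ℝ) (f : SdotDual d) : ℝ≥0∞ :=
  ⨆ N : ℕ, (∑' j : Set.Iic (N : ℤ),
    (2 : ℝ≥0∞) ^ (((j : ℤ) : ℝ) * β) * linftyNorm (φ.block j f)) / ENNReal.ofReal (G N)

/-- The norm of the intersection of the Vishik space with smoothness `β` and the Besov space
with smoothness `β - κ`. -/
def vishikBesovNorm {d : ℕ} (φ : LittlewoodPaley d) (β κ : ℝ) (G : ℝ → ℝ) (f : SdotDual d) :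
    ℝ≥0∞ :=
  max (vishikNorm φ β G f) (besovNorm φ (β - κ) f)

/-! ### The Biot-Savart law -/

/-- Riesz-type transforms `R = (R_1, …, R_d)`: each `R_l` is the Fourier multiplier whose symbol is
homogeneous of degree `0` and smooth away from the origin. -/
structure RieszType (d : ℕ) where
  symbol : Fin d → Rd d → ℂ
  smooth : ∀ l, ContDiffOn ℝ ∞ (symbol l) {0}ᶜ
  homogeneous : ∀ l (t : ℝ) (ξ : Rd d), 0 < t → ξ ≠ 0 → symbol l (t • ξ) = symbol l ξ

namespace RieszType

/-- The Riesz-type transform with symbols `i L_l(ξ) / |ξ|`, for linear forms `L_l`. -/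
def ofLinear {d : ℕ} (L : Fin d → Rd d →L[ℝ] ℝ) : RieszType d where
  symbol l ξ := Complex.I * ((L l ξ / ‖ξ‖ : ℝ) : ℂ)
  smooth l := by
    have h : ContDiffOn ℝ ∞ (fun ξ : Rd d => L l ξ / ‖ξ‖) {0}ᶜ := fun ξ hξ =>
      ((L l).contDiff.contDiffAt.div (contDiffAt_norm ℝ hξ)
        (norm_ne_zero_iff.2 hξ)).contDiffWithinAt
    exact contDiffOn_const.mul (Complex.ofRealCLM.contDiff.comp_contDiffOn h)
  homogeneous l t ξ ht _ := by
    have : L l (t • ξ) / ‖t • ξ‖ = L l ξ / ‖ξ‖ := by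
      rw [map_smul, norm_smul, Real.norm_of_nonneg ht.le, smul_eq_mul,
        mul_div_mul_left _ _ ht.ne']
    rw [this]

/-- The Riesz transforms `∇ (-Δ)^{-1/2}`, with symbol `i ξ / |ξ|`. -/
def riesz (d : ℕ) : RieszType d := ofLinear fun l => EuclideanSpace.proj l

/-- The planar transform `∇^⊥ (-Δ)^{-1/2}`, with symbol `i (-ξ_2, ξ_1) / |ξ|`, which gives the
(generalized) surface quasi-geostrophic equations and the vorticity form of Euler's equations. -/
def perp : RieszType 2 := ofLinear ![-EuclideanSpace.proj 1, EuclideanSpace.proj 0]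

end RieszType

/-- `w = T f` in `SdotDual d`, where `T` is the Fourier multiplier with symbol `σ`. This is
`⟨w, ψ⟩ = ⟨f, Tᵗ ψ⟩` for all `ψ` in `Sdot d`, where `χ = Tᵗ ψ` is given by `𝓕⁻ χ = σ 𝓕⁻ ψ`. -/
def IsMultiplierImage {d : ℕ} (σ : Rd d → ℂ) (f w : SdotDual d) : Prop :=
  ∀ ψ : Sdot d, ∃ χ : Sdot d,
    (∀ ξ, (𝓕⁻ (χ : 𝓢(Rd d, ℂ)) : 𝓢(Rd d, ℂ)) ξ = σ ξ * (𝓕⁻ (ψ : 𝓢(Rd d, ℂ)) : 𝓢(Rd d, ℂ)) ξ) ∧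
      w ψ = f χ

/-- The symbol of `R_l (-Δ)^{(β-1)/2}`; the Fourier transform is normalized with
`exp (-2πi x·ξ)`, so that `-Δ` has the symbol `(2π|ξ|)^2`. -/
def velocitySymbol {d : ℕ} (R : RieszType d) (β : ℝ) (l : Fin d) (ξ : Rd d) : ℂ :=
  R.symbol l ξ * (((2 * Real.pi * ‖ξ‖) ^ (β - 1) : ℝ) : ℂ)

/-- The bounded continuous vector field `V` represents `v = R (-Δ)^{(β-1)/2} w`, where `v` is a
vector of tempered distributions modulo polynomials. -/
def IsVelocity {d : ℕ} (R : RieszType d) (β : ℝ) (w : SdotDual d)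
    (V : Rd d →ᵇ EuclideanSpace ℂ (Fin d)) : Prop :=
  ∃ v : Fin d → SdotDual d,
    (∀ l, IsMultiplierImage (velocitySymbol R β l) w (v l)) ∧
      ∀ l (ψ : Sdot d), v l ψ = ∫ x, (ψ : 𝓢(Rd d, ℂ)) x * V x l

end

/-! Let `s` be the symbol of one component of the Biot-Savart law, homogeneous of degree `β - 1`,
and let `M` be `s` cut off smoothly to an annulus containing the support of `φ`. By homogeneity the
component equals `∑ j, 2^{j(β-1)} M(2^{-j}D) Δ_j ω`. The kernel of `M(2^{-j}D)` has `L¹` norm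
independent of `j`, and its gradient has `L¹` norm of order `2^j`. So the `j`-th term is bounded by
a constant times `2^{j(β-1)} ‖Δ_j ω‖_∞`, and its increment over a distance `r` carries the extra
factor `min(1, 2^j r)`. The Besov norm makes the series converge uniformly to a bounded continuous
function.

For `r < 1` the sum of increments is cut at `2^N ~ 1/r` (`IsGrowth.exists_dyadic_sum_le`). Below `N`
the factor `2^j r` turns the weight `β - 1` into `β`, and the Vishik norm gives `r G(N)`. Above `N`
each block is at most `2^{-jβ} G(j)` times the norm, and the tail condition on `G` gives `2^{-N}
G(N) ≲ r G(N)`. Finally `G(N) ≲ y_G(1/r)` by doubling (`IsGrowth.exists_le_mul_yudovich`). For `r ≥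
1` the Besov norm alone suffices.

Since `ω` is only a functional on `Sdot d`, the series has to be justified by duality. In
`exists_multiplier_transpose` the transposed multiplier applied to a test function is expanded into
dyadic pieces, and flatness of `𝓕⁻ ψ` at the origin makes this expansion converge in the Schwartz
topology, so that `ω` may be applied term by term. A bounded representative is unique up to a
constant vector by a Liouville argument (`eq_of_forall_integral_Sdot_eq_zero`), so the modulus of
continuity passes to every representative. -/

noncomputable section

/-! ### Lower bounds for the Yudovich function -/

section Yudovich

variable {κ : ℝ} {G : ℝ → ℝ}

theorem le_yudovich {c r : ℝ} (h : ∀ p : ℝ, 1 < p → c ≤ G p * r ^ (1 / p)) : c ≤ yudovich G r := by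
  have : Nonempty (Set.Ioi (1 : ℝ)) := ⟨⟨2, by norm_num⟩⟩
  exact le_ciInf fun p => h p p.2

theorem IsGrowth.yudovich_nonneg (hG : IsGrowth κ G) {r : ℝ} (hr : 0 ≤ r) : 0 ≤ yudovich G r :=
  le_yudovich fun p hp => mul_nonneg (hG.pos p (by linarith)).le (Real.rpow_nonneg hr _)

/-- For `r ≥ 1` and `p > 1` the power `(1/r)^{1/p}` is at least `1/r`, so `r y_G(1/r)` stays bounded
below. This covers large separations. -/
theorem IsGrowth.le_mul_yudovich_of_one_le (hG : IsGrowth κ G) {r : ℝ} (hr : 1 ≤ r) :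
    G 1 ≤ r * yudovich G (1 / r) := by
  have hr0 : 0 < r := by linarith
  rw [← div_le_iff₀' hr0]
  refine le_yudovich fun p hp => ?_
  have h1 : G 1 ≤ G p := hG.mono 1 p (by norm_num) hp.le
  have h2 : 1 / r ≤ (1 / r) ^ (1 / p) := by
    conv_lhs => rw [← Real.rpow_one (1 / r)]
    refine Real.rpow_le_rpow_of_exponent_ge (by positivity) ((div_le_one hr0).2 hr) ?_
    rw [div_le_one (by linarith)]; exact hp.le
  rw [div_eq_mul_one_div]
  exact mul_le_mul h1 h2 (by positivity) (hG.pos p (by linarith)).le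

theorem le_pow_mul_of_doubling {A : ℝ} (hA0 : 0 ≤ A)
    (hA : ∀ t, 0 ≤ t → G (2 * t) ≤ A * G t) (m : ℕ) {t : ℝ} (ht : 0 ≤ t) :
    G (2 ^ m * t) ≤ A ^ m * G t := by
  induction m with
  | zero => simp
  | succ m ih =>
    calc G (2 ^ (m + 1) * t) = G (2 * (2 ^ m * t)) := by ring_nf
      _ ≤ A * G (2 ^ m * t) := hA _ (by positivity)
      _ ≤ A * (A ^ m * G t) := by gcongr
      _ = _ := by ring

/-- Iterated doubling is beaten by double exponentials. -/
theorem exists_pow_le_mul_two_rpow (A : ℝ) :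
    ∃ C : ℝ, 1 ≤ C ∧ ∀ m : ℕ, A ^ (m + 1) ≤ C * (2 : ℝ) ^ ((2 : ℝ) ^ m) := by
  -- With `|A| < 2^K`, the power `|A|^m` is at most the polynomial `x^K` in `x = 2^m`, and `x^K /
  -- K!` scaled by `log 2` is below `exp(x log 2) = 2^x`.
  obtain ⟨K, hK⟩ := pow_unbounded_of_one_lt |A| (one_lt_two (α := ℝ))
  have hl : 0 < Real.log 2 := Real.log_pos one_lt_two
  refine ⟨max (|A| * (K.factorial / Real.log 2 ^ K)) 1, le_max_right _ _, fun m => ?_⟩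
  have h1 : ((2 : ℝ) ^ m) ^ K ≤ K.factorial / Real.log 2 ^ K * (2 : ℝ) ^ ((2 : ℝ) ^ m) := by
    have := Real.pow_div_factorial_le_exp (Real.log 2 * 2 ^ m) (by positivity) K
    rw [div_le_iff₀ (by positivity), mul_pow] at this
    rw [div_mul_eq_mul_div, le_div_iff₀ (by positivity), Real.rpow_def_of_pos two_pos]
    linarith
  have h2 : |A| ^ m ≤ ((2 : ℝ) ^ m) ^ K := by
    rw [← pow_mul, mul_comm, pow_mul]
    gcongr
  calc A ^ (m + 1) ≤ |A| ^ (m + 1) := by rw [← abs_pow]; exact le_abs_self _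
    _ = |A| * |A| ^ m := by ring
    _ ≤ |A| * (K.factorial / Real.log 2 ^ K * (2 : ℝ) ^ ((2 : ℝ) ^ m)) := by
        gcongr; exact h2.trans h1
    _ = |A| * (K.factorial / Real.log 2 ^ K) * (2 : ℝ) ^ ((2 : ℝ) ^ m) := by ring
    _ ≤ _ := by gcongr; exact le_max_left _ _

/-- Each `p` in the infimum is compared with `N`. If `p ≥ N`, monotonicity is enough. If `p < N`,
passing from `p` to `N` takes `m + 1` doublings, where `2^m ≤ N/p < 2^{m+1}`; their cost `A^{m+1}`
is absorbed by `r^{-1/p} ≥ 2^{N/p} ≥ 2^{2^m}`. -/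
theorem IsGrowth.exists_le_mul_yudovich (hG : IsGrowth κ G) :
    ∃ C : ℝ, 0 ≤ C ∧ ∀ (N : ℕ) (r : ℝ), 0 < r → r ≤ (2 : ℝ) ^ (-(N : ℝ)) →
      G N ≤ C * yudovich G (1 / r) := by
  obtain ⟨A, hA⟩ := hG.doubling
  have hA0 : 0 ≤ A := by
    have h1 := hA 0 le_rfl
    rw [mul_zero] at h1
    have h0 := hG.pos 0 le_rfl
    by_contra! h
    nlinarith
  obtain ⟨C, hC1, hC⟩ := exists_pow_le_mul_two_rpow A
  have hC0 : 0 < C := by linarith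
  refine ⟨C, hC0.le, fun N r hr hrN => ?_⟩
  rw [← div_le_iff₀' hC0]
  refine le_yudovich fun p hp => ?_
  have hp0 : 0 < p := by linarith
  rw [div_le_iff₀' hC0]
  have hGp := hG.pos p hp0.le
  have h1 : (2 : ℝ) ^ ((N : ℝ) / p) ≤ (1 / r) ^ (1 / p) := by
    rw [div_eq_mul_one_div, Real.rpow_mul two_pos.le]
    refine Real.rpow_le_rpow (by positivity) ?_ (by positivity)
    rw [le_div_iff₀ hr]
    calc (2 : ℝ) ^ (N : ℝ) * r ≤ (2 : ℝ) ^ (N : ℝ) * (2 : ℝ) ^ (-(N : ℝ)) := by gcongr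
      _ = 1 := by rw [← Real.rpow_add two_pos]; simp
  have key : G N ≤ C * (G p * (2 : ℝ) ^ ((N : ℝ) / p)) := by
    rcases le_or_gt (N : ℝ) p with hNp | hNp
    · have h2 : (1 : ℝ) ≤ (2 : ℝ) ^ ((N : ℝ) / p) := Real.one_le_rpow one_le_two (by positivity)
      calc G N ≤ G p := hG.mono _ _ (by positivity) hNp
        _ ≤ G p * (2 : ℝ) ^ ((N : ℝ) / p) := le_mul_of_one_le_right hGp.le h2
        _ ≤ _ := le_mul_of_one_le_left (by positivity) hC1
    · obtain ⟨m, hm1, hm2⟩ := exists_nat_pow_near ((one_le_div hp0).2 hNp.le) (one_lt_two (α := ℝ))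
      calc G N ≤ G (2 ^ (m + 1) * p) :=
            hG.mono _ _ (by positivity) ((div_lt_iff₀ hp0).1 hm2).le
        _ ≤ A ^ (m + 1) * G p := le_pow_mul_of_doubling hA0 hA _ hp0.le
        _ ≤ (C * (2 : ℝ) ^ ((2 : ℝ) ^ m)) * G p := by gcongr; exact hC m
        _ ≤ (C * (2 : ℝ) ^ ((N : ℝ) / p)) * G p := by
            gcongr
            exact one_le_two
        _ = _ := by ring
  exact key.trans (by gcongr)

end Yudovich

/-! ### Summation over dyadic blocks -/

theorem IsGrowth.exists_ennreal_tail_le {G : ℝ → ℝ} (hG : IsGrowth 1 G) :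
    ∃ D : ℝ≥0∞, D ≠ ⊤ ∧ ∀ N : ℕ,
      ∑' k : ℕ, (2 : ℝ≥0∞) ^ (-((N + k : ℕ) : ℝ)) * ENNReal.ofReal (G ((N + k : ℕ) : ℝ))
        ≤ D * ((2 : ℝ≥0∞) ^ (-(N : ℝ)) * ENNReal.ofReal (G N)) := by
  obtain ⟨D, hD⟩ := hG.tail
  have h2 : ∀ s : ℝ, (2 : ℝ≥0∞) ^ s = ENNReal.ofReal ((2 : ℝ) ^ s) := fun s => by
    rw [← ENNReal.ofReal_rpow_of_pos two_pos, ENNReal.ofReal_ofNat]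
  refine ⟨ENNReal.ofReal D, ENNReal.ofReal_ne_top, fun N => ?_⟩
  obtain ⟨hs, ht⟩ := hD N
  have hnn : ∀ n : ℕ, 0 ≤ G n := fun n => (hG.pos _ n.cast_nonneg).le
  simp only [mul_one] at hs ht
  have hD0 : 0 ≤ D := by
    have h0 : 0 < (2 : ℝ) ^ (-(N : ℝ)) * G N :=
      mul_pos (by positivity) (hG.pos _ N.cast_nonneg)
    exact nonneg_of_mul_nonneg_left
      ((tsum_nonneg fun k => mul_nonneg (by positivity) (hnn _)).trans ht) h0
  simp_rw [h2]
  simp_rw [← ENNReal.ofReal_mul (Real.rpow_nonneg two_pos.le _)]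
  rw [← ENNReal.ofReal_mul hD0, ← ENNReal.ofReal_tsum_of_nonneg
    (fun k => mul_nonneg (by positivity) (hnn _)) hs]
  exact ENNReal.ofReal_le_ofReal ht

/-- Splitting a sum over dyadic scales at the scale `2 ^ (-N)`. -/
theorem tsum_int_le_split (f : ℤ → ℝ≥0∞) (N : ℕ) :
    ∑' j : ℤ, f j ≤ ∑' j : Set.Iic (N : ℤ), f j + ∑' k : ℕ, f ((N + k : ℕ) : ℤ) := by
  -- The two halves overlap at `j = N`, which is harmless for an upper bound.
  have hu : Set.Iic (N : ℤ) ∪ Set.Ici (N : ℤ) = Set.univ := Set.Iic_union_Ici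
  have e : ∑' j : Set.Ici (N : ℤ), f j = ∑' k : ℕ, f ((N + k : ℕ) : ℤ) := by
    let E : ℕ ≃ Set.Ici (N : ℤ) :=
      { toFun := fun k => ⟨((N + k : ℕ) : ℤ), by simp⟩
        invFun := fun j => ((j : ℤ) - N).toNat
        left_inv := fun k => by simp
        right_inv := fun j => by
          have := j.2
          rw [Set.mem_Ici] at this
          ext
          push_cast
          omega }
    rw [← E.tsum_eq]
    rfl
  rw [← e, ← tsum_univ f, ← hu]
  exact ENNReal.tsum_union_le _ _ _

/-- The dyadic estimate behind the modulus of continuity: `a j` plays the role of the norm of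
the `j`-th dyadic block. -/
theorem IsGrowth.exists_dyadic_sum_le {G : ℝ → ℝ} (hG : IsGrowth 1 G) (β : ℝ) :
    ∃ C : ℝ≥0∞, C ≠ ⊤ ∧ ∀ (a : ℤ → ℝ≥0∞) (X : ℝ≥0∞),
      (∀ N : ℕ, ∑' j : Set.Iic (N : ℤ), (2 : ℝ≥0∞) ^ (((j : ℤ) : ℝ) * β) * a j
        ≤ X * ENNReal.ofReal (G N)) →
      ∑' j : ℤ, (2 : ℝ≥0∞) ^ ((j : ℝ) * (β - 1)) * a j ≤ X →
      ∀ r : ℝ, 0 < r →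
        ∑' j : ℤ, (2 : ℝ≥0∞) ^ ((j : ℝ) * (β - 1)) * a j *
          min 1 ((2 : ℝ≥0∞) ^ (j : ℝ) * ENNReal.ofReal r)
          ≤ C * (ENNReal.ofReal (r * yudovich G (1 / r)) * X) := by
  obtain ⟨D, hD, hDt⟩ := hG.exists_ennreal_tail_le
  obtain ⟨C, hC0, hC⟩ := hG.exists_le_mul_yudovich
  have hG1 := hG.pos 1 zero_le_one
  -- The first summand serves `r ≥ 1`, the second `r < 1`; in the latter, `1` comes from low
  -- frequencies and `2 * D` from high ones.
  refine ⟨ENNReal.ofReal (1 / G 1) + (1 + 2 * D) * ENNReal.ofReal C, by finiteness, ?_⟩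
  intro a X hV hB r hr
  have h2 : ∀ s t : ℝ, (2 : ℝ≥0∞) ^ s * (2 : ℝ≥0∞) ^ t = (2 : ℝ≥0∞) ^ (s + t) := fun s t =>
    (ENNReal.rpow_add s t two_ne_zero ENNReal.ofNat_ne_top).symm
  rcases le_or_gt 1 r with h1r | hr1
  · calc ∑' j : ℤ, (2 : ℝ≥0∞) ^ ((j : ℝ) * (β - 1)) * a j *
          min 1 ((2 : ℝ≥0∞) ^ (j : ℝ) * ENNReal.ofReal r)
        ≤ ∑' j : ℤ, (2 : ℝ≥0∞) ^ ((j : ℝ) * (β - 1)) * a j :=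
          ENNReal.tsum_le_tsum fun j => mul_le_of_le_one_right' (min_le_left _ _)
      _ ≤ X := hB
      _ = ENNReal.ofReal 1 * X := by simp
      _ ≤ ENNReal.ofReal (1 / G 1 * (r * yudovich G (1 / r))) * X := by
          gcongr
          have := hG.le_mul_yudovich_of_one_le h1r
          rw [div_mul_eq_mul_div, one_mul, le_div_iff₀ hG1, one_mul]
          exact this
      _ ≤ _ := by
          rw [ENNReal.ofReal_mul (by positivity), mul_assoc]
          gcongr
          exact le_self_add
  -- The cut is at `2^N ≤ 1/r < 2^{N+1}`, so `2^{-N}` and `r` agree up to a factor `2`.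
  · obtain ⟨N, hN1, hN2⟩ := exists_nat_pow_near (one_le_one_div hr hr1.le) (one_lt_two (α := ℝ))
    have hrN : r ≤ (2 : ℝ) ^ (-(N : ℝ)) := by
      rw [Real.rpow_neg two_pos.le, Real.rpow_natCast, ← one_div]
      rwa [le_div_iff₀ hr, ← le_div_iff₀' (by positivity)] at hN1
    have hNr : (2 : ℝ) ^ (-(N : ℝ)) ≤ 2 * r := by
      rw [Real.rpow_neg two_pos.le, Real.rpow_natCast, inv_le_iff_one_le_mul₀ (by positivity)]
      rw [div_lt_iff₀ hr, pow_succ] at hN2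
      linarith
    have hNr' : (2 : ℝ≥0∞) ^ (-(N : ℝ)) ≤ 2 * ENNReal.ofReal r := by
      have := ENNReal.ofReal_le_ofReal hNr
      rwa [← ENNReal.ofReal_rpow_of_pos two_pos, ENNReal.ofReal_mul two_pos.le,
        ENNReal.ofReal_ofNat] at this
    have hlow : ∑' j : Set.Iic (N : ℤ), (2 : ℝ≥0∞) ^ (((j : ℤ) : ℝ) * (β - 1)) * a j *
        min 1 ((2 : ℝ≥0∞) ^ ((j : ℤ) : ℝ) * ENNReal.ofReal r)
          ≤ ENNReal.ofReal r * (X * ENNReal.ofReal (G N)) := by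
      refine le_trans ?_ (mul_le_mul_right (hV N) _)
      rw [← ENNReal.tsum_mul_left]
      refine ENNReal.tsum_le_tsum fun j => ?_
      calc _ ≤ (2 : ℝ≥0∞) ^ (((j : ℤ) : ℝ) * (β - 1)) * a j *
            ((2 : ℝ≥0∞) ^ ((j : ℤ) : ℝ) * ENNReal.ofReal r) := by gcongr; exact min_le_right _ _
        _ = ((2 : ℝ≥0∞) ^ (((j : ℤ) : ℝ) * (β - 1)) * (2 : ℝ≥0∞) ^ ((j : ℤ) : ℝ)) *
            (ENNReal.ofReal r * a j) := by ring
        _ = _ := by rw [h2]; ring_nf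
    -- A single block is bounded by the Vishik partial sum ending at its own index, so the bound
    -- involves `G n` and the tail condition applies.
    have hsingle : ∀ n : ℕ, (2 : ℝ≥0∞) ^ ((n : ℝ) * β) * a n ≤ X * ENNReal.ofReal (G n) :=
      fun n => le_trans (by
        simpa using ENNReal.le_tsum
          (f := fun j : Set.Iic (n : ℤ) => (2 : ℝ≥0∞) ^ (((j : ℤ) : ℝ) * β) * a j)
          ⟨(n : ℤ), Set.mem_Iic.2 le_rfl⟩) (hV n)
    have hhigh : ∑' k : ℕ, (2 : ℝ≥0∞) ^ ((((N + k : ℕ) : ℤ) : ℝ) * (β - 1)) * a ((N + k : ℕ) : ℤ) *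
        min 1 ((2 : ℝ≥0∞) ^ (((N + k : ℕ) : ℤ) : ℝ) * ENNReal.ofReal r)
          ≤ X * (D * ((2 : ℝ≥0∞) ^ (-(N : ℝ)) * ENNReal.ofReal (G N))) := by
      refine le_trans ?_ (mul_le_mul_right (hDt N) _)
      rw [← ENNReal.tsum_mul_left]
      refine ENNReal.tsum_le_tsum fun k => ?_
      refine (mul_le_of_le_one_right' (min_le_left _ _)).trans ?_
      rw [Int.cast_natCast]
      set n := N + k
      calc (2 : ℝ≥0∞) ^ ((n : ℝ) * (β - 1)) * a n
          = (2 : ℝ≥0∞) ^ (-(n : ℝ)) * ((2 : ℝ≥0∞) ^ ((n : ℝ) * β) * a n) := by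
            rw [← mul_assoc, h2]; ring_nf
        _ ≤ (2 : ℝ≥0∞) ^ (-(n : ℝ)) * (X * ENNReal.ofReal (G n)) := mul_le_mul_right (hsingle n) _
        _ = _ := by ring
    calc _ ≤ _ := tsum_int_le_split _ N
      _ ≤ ENNReal.ofReal r * (X * ENNReal.ofReal (G N)) +
          X * (D * (2 * ENNReal.ofReal r * ENNReal.ofReal (G N))) := by
          refine add_le_add hlow (hhigh.trans ?_)
          gcongr
      _ = (1 + 2 * D) * (ENNReal.ofReal r * ENNReal.ofReal (G N) * X) := by ring
      _ ≤ (1 + 2 * D) * (ENNReal.ofReal r * ENNReal.ofReal (C * yudovich G (1 / r)) * X) := by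
          gcongr
          exact hC N r hr hrN
      _ = (1 + 2 * D) * ENNReal.ofReal C * (ENNReal.ofReal (r * yudovich G (1 / r)) * X) := by
          rw [ENNReal.ofReal_mul hC0, ENNReal.ofReal_mul hr.le]; ring
      _ ≤ _ := by gcongr; exact le_add_self

/-! ### Absolutely convergent series of Schwartz functions -/

section Series

variable {E F ι : Type*} [NormedAddCommGroup E] [NormedSpace ℝ E] [NormedAddCommGroup F]
  [NormedSpace ℝ F]

theorem SchwartzMap.norm_iteratedFDeriv_le_seminorm_zero (f : 𝓢(E, F)) (n : ℕ) (x : E) :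
    ‖iteratedFDeriv ℝ n f x‖ ≤ SchwartzMap.seminorm ℝ 0 n f := by
  simpa using SchwartzMap.le_seminorm ℝ 0 n f x

variable [CompleteSpace F]

/-- The pointwise sum of an absolutely convergent series of Schwartz functions. -/
def SchwartzMap.tsumOfSummable (f : ι → 𝓢(E, F))
    (h : ∀ k n, Summable fun i => SchwartzMap.seminorm ℝ k n (f i)) : 𝓢(E, F) where
  toFun x := ∑' i, f i x
  smooth' := contDiff_tsum (N := ⊤) (v := fun n i => SchwartzMap.seminorm ℝ 0 n (f i))
    (fun i => (f i).smooth ⊤) (fun n _ => h 0 n)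
    fun n i x _ => (f i).norm_iteratedFDeriv_le_seminorm_zero n x
  decay' k n := by
    refine ⟨∑' i, SchwartzMap.seminorm ℝ k n (f i), fun x => ?_⟩
    rw [iteratedFDeriv_tsum_apply (N := ⊤) (v := fun n i => SchwartzMap.seminorm ℝ 0 n (f i))
      (fun i => (f i).smooth ⊤) (fun n _ => h 0 n)
      (fun n i x _ => (f i).norm_iteratedFDeriv_le_seminorm_zero n x) (by simp)]
    have hs : Summable fun i => ‖iteratedFDeriv ℝ n (f i) x‖ :=
      (h 0 n).of_nonneg_of_le (fun _ => norm_nonneg _)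
        fun i => (f i).norm_iteratedFDeriv_le_seminorm_zero n x
    calc ‖x‖ ^ k * ‖∑' i, iteratedFDeriv ℝ n (f i) x‖
        ≤ ‖x‖ ^ k * ∑' i, ‖iteratedFDeriv ℝ n (f i) x‖ := by
          gcongr; exact norm_tsum_le_tsum_norm hs
      _ = ∑' i, ‖x‖ ^ k * ‖iteratedFDeriv ℝ n (f i) x‖ := tsum_mul_left.symm
      _ ≤ _ := (hs.mul_left _).tsum_le_tsum (fun i => SchwartzMap.le_seminorm ℝ k n (f i) x)
          (h k n)

theorem SchwartzMap.tsumOfSummable_apply (f : ι → 𝓢(E, F))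
    (h : ∀ k n, Summable fun i => SchwartzMap.seminorm ℝ k n (f i)) (x : E) :
    SchwartzMap.tsumOfSummable f h x = ∑' i, f i x := rfl

theorem SchwartzMap.iteratedFDeriv_tsumOfSummable (f : ι → 𝓢(E, F))
    (h : ∀ k n, Summable fun i => SchwartzMap.seminorm ℝ k n (f i)) (n : ℕ) (x : E) :
    iteratedFDeriv ℝ n (SchwartzMap.tsumOfSummable f h) x = ∑' i, iteratedFDeriv ℝ n (f i) x :=
  iteratedFDeriv_tsum_apply (N := ⊤) (v := fun n i => SchwartzMap.seminorm ℝ 0 n (f i))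
    (fun i => (f i).smooth ⊤) (fun n _ => h 0 n)
    (fun n i x _ => (f i).norm_iteratedFDeriv_le_seminorm_zero n x) (by simp) x

theorem SchwartzMap.seminorm_tsumOfSummable_le (f : ι → 𝓢(E, F))
    (h : ∀ k n, Summable fun i => SchwartzMap.seminorm ℝ k n (f i)) (k n : ℕ) :
    SchwartzMap.seminorm ℝ k n (SchwartzMap.tsumOfSummable f h)
      ≤ ∑' i, SchwartzMap.seminorm ℝ k n (f i) := by
  refine SchwartzMap.seminorm_le_bound ℝ k n _ (tsum_nonneg fun i => apply_nonneg _ _) fun x => ?_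
  have hs : Summable fun i => ‖iteratedFDeriv ℝ n (f i) x‖ :=
    (h 0 n).of_nonneg_of_le (fun _ => norm_nonneg _)
      fun i => (f i).norm_iteratedFDeriv_le_seminorm_zero n x
  rw [SchwartzMap.iteratedFDeriv_tsumOfSummable]
  calc ‖x‖ ^ k * ‖∑' i, iteratedFDeriv ℝ n (f i) x‖
      ≤ ‖x‖ ^ k * ∑' i, ‖iteratedFDeriv ℝ n (f i) x‖ := by
        gcongr; exact norm_tsum_le_tsum_norm hs
    _ = ∑' i, ‖x‖ ^ k * ‖iteratedFDeriv ℝ n (f i) x‖ := tsum_mul_left.symm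
    _ ≤ _ := (hs.mul_left _).tsum_le_tsum (fun i => SchwartzMap.le_seminorm ℝ k n (f i) x)
        (h k n)

theorem SchwartzMap.summable_apply (f : ι → 𝓢(E, F))
    (h : ∀ k n, Summable fun i => SchwartzMap.seminorm ℝ k n (f i)) (x : E) :
    Summable fun i => f i x :=
  (h 0 0).of_norm_bounded fun i => SchwartzMap.norm_le_seminorm ℝ (f i) x

/-- The remainder after a finite partial sum is again such a series, so each of its seminorms is at
most a tail of a convergent series. -/
theorem SchwartzMap.hasSum_tsumOfSummable (f : ι → 𝓢(E, F))
    (h : ∀ k n, Summable fun i => SchwartzMap.seminorm ℝ k n (f i)) :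
    HasSum f (SchwartzMap.tsumOfSummable f h) := by
  have hsub : ∀ (s : Finset ι) (k n : ℕ),
      Summable fun i : {i // i ∉ s} => SchwartzMap.seminorm ℝ k n (f i) :=
    fun s k n => (h k n).subtype _
  have hdiff : ∀ s : Finset ι, SchwartzMap.tsumOfSummable f h - ∑ i ∈ s, f i
      = SchwartzMap.tsumOfSummable (fun i : {i // i ∉ s} => f i) (hsub s) := by
    intro s
    ext x
    rw [_root_.sub_apply, _root_.sum_apply, SchwartzMap.tsumOfSummable_apply,
      SchwartzMap.tsumOfSummable_apply, sub_eq_iff_eq_add']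
    exact ((SchwartzMap.summable_apply f h x).sum_add_tsum_subtype_compl s).symm
  rw [HasSum, (schwartz_withSeminorms ℝ E F).tendsto_nhds]
  rintro ⟨k, n⟩ ε hε
  have ht := (tendsto_tsum_compl_atTop_zero fun i => SchwartzMap.seminorm ℝ k n (f i))
  filter_upwards [ht.eventually (gt_mem_nhds hε)] with s hs
  rw [schwartzSeminormFamily_apply, ← neg_sub, map_neg_eq_map, hdiff]
  exact (SchwartzMap.seminorm_tsumOfSummable_le _ (hsub s) k n).trans_lt hs

end Series

/-! ### Schwartz functions that are flat at the origin -/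

section Flat

variable {E F : Type*} [NormedAddCommGroup E] [NormedSpace ℝ E] [NormedAddCommGroup F]
  [NormedSpace ℝ F]

/-- The mean value inequality on the ball of radius `‖x‖` gains one power of `‖x‖` from the bound on
the next derivative; hence the induction on `N` with `n` free. -/
theorem SchwartzMap.exists_norm_iteratedFDeriv_le_pow (g : 𝓢(E, F))
    (hg : ∀ n, iteratedFDeriv ℝ n g 0 = 0) (N n : ℕ) :
    ∃ C, 0 ≤ C ∧ ∀ x, ‖iteratedFDeriv ℝ n g x‖ ≤ C * ‖x‖ ^ N := by
  induction N generalizing n with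
  | zero =>
    exact ⟨SchwartzMap.seminorm ℝ 0 n g, apply_nonneg _ _, fun x => by
      simpa using SchwartzMap.le_seminorm ℝ 0 n g x⟩
  | succ N ih =>
    obtain ⟨C, hC0, hC⟩ := ih (n + 1)
    refine ⟨C, hC0, fun x => ?_⟩
    have hd : Differentiable ℝ (iteratedFDeriv ℝ n g) :=
      (g.smooth ⊤).differentiable_iteratedFDeriv (by exact_mod_cast WithTop.coe_lt_top _)
    have := (convex_closedBall (0 : E) ‖x‖).norm_image_sub_le_of_norm_fderiv_le (𝕜 := ℝ)
      (f := iteratedFDeriv ℝ n g) (C := C * ‖x‖ ^ N) (x := 0) (y := x)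
      (fun y _ => hd y) (fun y hy => ?_) (by simp) (by simp)
    · rw [hg n, sub_zero, sub_zero] at this
      rw [pow_succ, ← mul_assoc]
      exact this
    · rw [norm_fderiv_iteratedFDeriv]
      refine (hC y).trans ?_
      gcongr
      simpa using hy

/-- Flatness gives the bound for `‖x‖ ≤ 1` and Schwartz decay for `‖x‖ ≥ 1`; one integer `N ≥ |q|`
serves both regimes. -/
theorem SchwartzMap.exists_pow_mul_norm_iteratedFDeriv_le_rpow (g : 𝓢(E, F))
    (hg : ∀ n, iteratedFDeriv ℝ n g 0 = 0) (k n : ℕ) (q : ℝ) :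
    ∃ C, 0 ≤ C ∧ ∀ x ≠ 0, ‖x‖ ^ k * ‖iteratedFDeriv ℝ n g x‖ ≤ C * ‖x‖ ^ q := by
  obtain ⟨N, hN⟩ := exists_nat_ge |q|
  obtain ⟨C, hC0, hC⟩ := g.exists_norm_iteratedFDeriv_le_pow hg N n
  refine ⟨max C (SchwartzMap.seminorm ℝ (k + N) n g), hC0.trans (le_max_left _ _), fun x hx => ?_⟩
  have hx0 : 0 < ‖x‖ := norm_pos_iff.2 hx
  rcases le_total ‖x‖ 1 with h1 | h1
  · calc ‖x‖ ^ k * ‖iteratedFDeriv ℝ n g x‖ ≤ 1 * (C * ‖x‖ ^ N) := by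
          gcongr
          · exact pow_le_one₀ hx0.le h1
          · exact hC x
      _ ≤ max C (SchwartzMap.seminorm ℝ (k + N) n g) * ‖x‖ ^ q := by
          rw [one_mul, ← Real.rpow_natCast]
          gcongr ?_ * ?_
          · exact le_max_left _ _
          · exact Real.rpow_le_rpow_of_exponent_ge hx0 h1 ((le_abs_self q).trans hN)
  · have h2 : 1 ≤ ‖x‖ ^ (N : ℝ) * ‖x‖ ^ q := by
      rw [← Real.rpow_add hx0]
      exact Real.one_le_rpow h1 (by linarith [neg_abs_le q])
    calc ‖x‖ ^ k * ‖iteratedFDeriv ℝ n g x‖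
        ≤ (‖x‖ ^ k * ‖iteratedFDeriv ℝ n g x‖) * (‖x‖ ^ (N : ℝ) * ‖x‖ ^ q) :=
          le_mul_of_one_le_right (by positivity) h2
      _ = (‖x‖ ^ (k + N) * ‖iteratedFDeriv ℝ n g x‖) * ‖x‖ ^ q := by
          rw [Real.rpow_natCast, pow_add]; ring
      _ ≤ _ := by
          gcongr
          exact (SchwartzMap.le_seminorm ℝ (k + N) n g x).trans (le_max_right _ _)

end Flat

/-! ### Dyadic dilations -/

section Dilation

variable {E : Type*} [NormedAddCommGroup E] [NormedSpace ℝ E]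

/-- The dilation `x ↦ m (2 ^ (-j) x)` of a Schwartz function. -/
def SchwartzMap.dyadicDilate (j : ℤ) (m : 𝓢(E, ℂ)) : 𝓢(E, ℂ) :=
  compCLMOfContinuousLinearEquiv ℂ
    (ContinuousLinearEquiv.smulLeft (R₁ := ℝ) (Units.mk0 ((2 : ℝ) ^ (-j)) (by positivity))) m

theorem SchwartzMap.dyadicDilate_apply (j : ℤ) (m : 𝓢(E, ℂ)) (x : E) :
    m.dyadicDilate j x = m ((2 : ℝ) ^ (-j) • x) := rfl

theorem SchwartzMap.coe_dyadicDilate (j : ℤ) (m : 𝓢(E, ℂ)) :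
    ⇑(m.dyadicDilate j) = fun x => m ((2 : ℝ) ^ (-j) • x) := rfl

/-- Localizing a function that is flat at the origin to a dyadic annulus makes it as small as
desired, both at low and at high frequencies. -/
theorem SchwartzMap.exists_seminorm_smulLeftCLM_dyadicDilate_le (m g : 𝓢(E, ℂ))
    (hm : tsupport m ⊆ {x | 1 / 2 ≤ ‖x‖ ∧ ‖x‖ ≤ 2})
    (hg : ∀ n, iteratedFDeriv ℝ n g 0 = 0) (k n : ℕ) (L : ℝ) :
    ∃ C, 0 ≤ C ∧ ∀ j : ℤ, SchwartzMap.seminorm ℝ k n (smulLeftCLM ℂ (m.dyadicDilate j) g)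
      ≤ C * (2 : ℝ) ^ ((j : ℝ) * L) := by
  -- Differentiating the dilated factor `i` times costs `2^{-ji}`. The exponent `L + i` for the
  -- other factor compensates this, since `‖x‖ ~ 2^j` on the support.
  choose C hC0 hC using fun i : ℕ =>
    g.exists_pow_mul_norm_iteratedFDeriv_le_rpow hg k (n - i) (L + i)
  refine ⟨∑ i ∈ Finset.range (n + 1), (n.choose i : ℝ) *
    (SchwartzMap.seminorm ℝ 0 i m * C i * (2 : ℝ) ^ |L + i|),
    Finset.sum_nonneg fun i _ => by have := hC0 i; positivity, fun j => ?_⟩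
  refine SchwartzMap.seminorm_le_bound ℝ k n _
    (mul_nonneg (Finset.sum_nonneg fun i _ => by have := hC0 i; positivity) (by positivity))
    fun x => ?_
  have e : ⇑(smulLeftCLM ℂ (m.dyadicDilate j) g) = fun y => m.dyadicDilate j y * g y := by
    ext y
    rw [smulLeftCLM_apply_apply (m.dyadicDilate j).hasTemperateGrowth, smul_eq_mul]
  rw [e]
  have hmul := norm_iteratedFDeriv_mul_le (𝕜 := ℝ) ((m.dyadicDilate j).smooth ⊤) (g.smooth ⊤) x
    (n := n) (by exact_mod_cast le_top)
  refine (mul_le_mul_of_nonneg_left hmul (by positivity)).trans ?_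
  rw [Finset.mul_sum, Finset.sum_mul]
  refine Finset.sum_le_sum fun i _ => ?_
  have hD : iteratedFDeriv ℝ i (m.dyadicDilate j) x
      = ((2 : ℝ) ^ (-j)) ^ i • iteratedFDeriv ℝ i m ((2 : ℝ) ^ (-j) • x) := by
    rw [SchwartzMap.coe_dyadicDilate, iteratedFDeriv_comp_const_smul _ (m.smooth i)]
  have hCi := hC0 i
  by_cases hx : (2 : ℝ) ^ (-j) • x ∈ tsupport m
  · obtain ⟨h1, h2⟩ := hm hx
    have h2j : (0 : ℝ) < 2 ^ (-j) := by positivity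
    rw [norm_smul, Real.norm_of_nonneg h2j.le] at h1 h2
    set t := (2 : ℝ) ^ (-j) * ‖x‖ with ht
    have ht0 : 0 < t := by linarith
    have hxt : ‖x‖ = (2 : ℝ) ^ (j : ℝ) * t := by
      rw [ht, ← mul_assoc, Real.rpow_intCast, ← zpow_add₀ two_ne_zero]; simp
    have hx0 : x ≠ 0 := by
      rintro rfl
      simp [ht] at ht0
    have htp : t ^ (L + i) ≤ (2 : ℝ) ^ |L + i| := by
      rcases le_total 0 (L + i) with h | h
      · rw [abs_of_nonneg h]
        exact Real.rpow_le_rpow ht0.le h2 h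
      · rw [abs_of_nonpos h, Real.rpow_neg two_pos.le, ← Real.inv_rpow two_pos.le]
        exact Real.rpow_le_rpow_of_nonpos (by norm_num) (by linarith) h
    have hpow : ((2 : ℝ) ^ (-j)) ^ i * ‖x‖ ^ (L + i) ≤ (2 : ℝ) ^ |L + i| * (2 : ℝ) ^ ((j : ℝ) * L) := by
      have e1 : ((2 : ℝ) ^ (-j)) ^ i = (2 : ℝ) ^ (-(j : ℝ) * i) := by
        rw [← zpow_natCast, ← zpow_mul, ← Real.rpow_intCast]; push_cast; ring_nf
      rw [hxt, Real.mul_rpow (by positivity) ht0.le, e1, ← Real.rpow_mul two_pos.le, ← mul_assoc,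
        ← Real.rpow_add two_pos, mul_comm]
      have e2 : -(j : ℝ) * i + j * (L + i) = j * L := by ring
      rw [e2]
      gcongr
    calc ‖x‖ ^ k * ((n.choose i : ℝ) * ‖iteratedFDeriv ℝ i (m.dyadicDilate j) x‖ *
          ‖iteratedFDeriv ℝ (n - i) g x‖)
        = (n.choose i : ℝ) * (‖iteratedFDeriv ℝ i m ((2 : ℝ) ^ (-j) • x)‖ *
          (((2 : ℝ) ^ (-j)) ^ i * (‖x‖ ^ k * ‖iteratedFDeriv ℝ (n - i) g x‖))) := by
          rw [hD, norm_smul, Real.norm_of_nonneg (by positivity)]; ring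
      _ ≤ (n.choose i : ℝ) * (SchwartzMap.seminorm ℝ 0 i m *
          (((2 : ℝ) ^ (-j)) ^ i * (C i * ‖x‖ ^ (L + i)))) := by
          gcongr (n.choose i : ℝ) * (?_ * (_ * ?_))
          · exact m.norm_iteratedFDeriv_le_seminorm_zero i _
          · exact hC i x hx0
      _ = (n.choose i : ℝ) * (SchwartzMap.seminorm ℝ 0 i m * C i *
          (((2 : ℝ) ^ (-j)) ^ i * ‖x‖ ^ (L + i))) := by ring
      _ ≤ (n.choose i : ℝ) * (SchwartzMap.seminorm ℝ 0 i m * C i *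
          ((2 : ℝ) ^ |L + i| * (2 : ℝ) ^ ((j : ℝ) * L))) := by gcongr
      _ = _ := by ring
  · have h0 : iteratedFDeriv ℝ i m ((2 : ℝ) ^ (-j) • x) = 0 := by
      by_contra h
      exact hx (support_iteratedFDeriv_subset (𝕜 := ℝ) i h)
    rw [hD, h0, smul_zero, norm_zero, mul_zero, zero_mul, mul_zero]
    positivity

theorem summable_two_rpow_neg_abs : Summable fun j : ℤ => (2 : ℝ) ^ (-|(j : ℝ)|) := by
  have h : Summable fun n : ℕ => (2 : ℝ) ^ (-(n : ℝ)) := by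
    have := summable_geometric_two
    refine this.congr fun n => ?_
    rw [Real.rpow_neg two_pos.le, Real.rpow_natCast, one_div, inv_pow]
  refine Summable.of_nat_of_neg ?_ ?_
  · simpa using h
  · simpa using h

/-- The localization estimate holds for every exponent: `L = 1 - a` is used for `j ≤ 0` and `L = -1
- a` for `j ≥ 0`, which leaves `2^{-|j|}` on both sides. -/
theorem SchwartzMap.summable_seminorm_smulLeftCLM_dyadicDilate (m g : 𝓢(E, ℂ))
    (hm : tsupport m ⊆ {x | 1 / 2 ≤ ‖x‖ ∧ ‖x‖ ≤ 2})
    (hg : ∀ n, iteratedFDeriv ℝ n g 0 = 0) (a : ℝ) (k n : ℕ) :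
    Summable fun j : ℤ => SchwartzMap.seminorm ℝ k n
      (((2 : ℝ) ^ ((j : ℝ) * a)) • smulLeftCLM ℂ (m.dyadicDilate j) g) := by
  obtain ⟨C, hC0, hC⟩ := m.exists_seminorm_smulLeftCLM_dyadicDilate_le g hm hg k n (1 - a)
  obtain ⟨C', hC'0, hC'⟩ := m.exists_seminorm_smulLeftCLM_dyadicDilate_le g hm hg k n (-1 - a)
  refine (summable_two_rpow_neg_abs.mul_left (max C C')).of_nonneg_of_le
    (fun _ => apply_nonneg _ _) fun j => ?_
  rw [map_smul_eq_mul, Real.norm_of_nonneg (by positivity)]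
  rcases le_total 0 (j : ℝ) with hj | hj
  · calc _ ≤ (2 : ℝ) ^ ((j : ℝ) * a) * (C' * (2 : ℝ) ^ ((j : ℝ) * (-1 - a))) := by
          gcongr; exact hC' j
      _ = C' * ((2 : ℝ) ^ ((j : ℝ) * a) * (2 : ℝ) ^ ((j : ℝ) * (-1 - a))) := by ring
      _ = C' * (2 : ℝ) ^ (-|(j : ℝ)|) := by
          rw [← Real.rpow_add two_pos, abs_of_nonneg hj]; ring_nf
      _ ≤ _ := by gcongr; exact le_max_right _ _
  · calc _ ≤ (2 : ℝ) ^ ((j : ℝ) * a) * (C * (2 : ℝ) ^ ((j : ℝ) * (1 - a))) := by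
          gcongr; exact hC j
      _ = C * ((2 : ℝ) ^ ((j : ℝ) * a) * (2 : ℝ) ^ ((j : ℝ) * (1 - a))) := by ring
      _ = C * (2 : ℝ) ^ (-|(j : ℝ)|) := by
          rw [← Real.rpow_add two_pos, abs_of_nonpos hj]; ring_nf
      _ ≤ _ := by gcongr; exact le_max_left _ _

end Dilation

/-! ### Convolution with dilated kernels -/

section Kernel

variable {d : ℕ}

theorem SchwartzMap.fourier_dyadicDilate_apply (j : ℤ) (m : 𝓢(Rd d, ℂ)) (x : Rd d) :
    (𝓕 (m.dyadicDilate j) : 𝓢(Rd d, ℂ)) x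
      = (((2 : ℝ) ^ j) ^ d : ℝ) • (𝓕 m : 𝓢(Rd d, ℂ)) ((2 : ℝ) ^ j • x) := by
  rw [fourier_coe, fourier_coe, Real.fourier_eq, Real.fourier_eq]
  have h := Measure.integral_comp_smul (volume : Measure (Rd d))
    (fun v => Real.fourierChar (-inner ℝ v ((2 : ℝ) ^ j • x)) • m v) ((2 : ℝ) ^ (-j))
  rw [finrank_euclideanSpace_fin] at h
  have e : |(((2 : ℝ) ^ (-j)) ^ d)⁻¹| = ((2 : ℝ) ^ j) ^ d := by
    rw [abs_of_nonneg (by positivity), zpow_neg, inv_pow, inv_inv]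
  rw [e] at h
  rw [← h]
  congr 1
  ext v
  rw [SchwartzMap.dyadicDilate_apply, inner_smul_left, inner_smul_right, ← mul_assoc]
  have e2 : (starRingEnd ℝ) ((2 : ℝ) ^ (-j)) * (2 : ℝ) ^ j = 1 := by
    rw [conj_trivial, ← zpow_add₀ two_ne_zero]; simp
  rw [e2, one_mul]

theorem SchwartzMap.integral_norm_fourier_dyadicDilate (j : ℤ) (m : 𝓢(Rd d, ℂ)) :
    ∫ x, ‖(𝓕 (m.dyadicDilate j) : 𝓢(Rd d, ℂ)) x‖ = ∫ x, ‖(𝓕 m : 𝓢(Rd d, ℂ)) x‖ := by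
  simp_rw [SchwartzMap.fourier_dyadicDilate_apply, norm_smul]
  rw [integral_const_mul, Measure.integral_comp_smul (volume : Measure (Rd d))
    (fun v => ‖(𝓕 m : 𝓢(Rd d, ℂ)) v‖) ((2 : ℝ) ^ j), finrank_euclideanSpace_fin, smul_eq_mul,
    ← mul_assoc, Real.norm_of_nonneg (by positivity), abs_of_nonneg (by positivity),
    mul_inv_cancel₀ (by positivity), one_mul]

/-- The increment is the integral of the derivative along the segment; Tonelli and translation
invariance then give the `L¹` bound. -/
theorem SchwartzMap.integral_norm_sub_translate_le (f : 𝓢(Rd d, ℂ)) (h : Rd d) :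
    ∫ z, ‖f (z + h) - f z‖ ≤ ‖h‖ * ∫ z, ‖fderivCLM ℝ (Rd d) ℂ f z‖ := by
  set f' := fderivCLM ℝ (Rd d) ℂ f with hf'
  have hi : Integrable fun z => f (z + h) - f z :=
    (f.integrable.comp_add_right h).sub f.integrable
  have hi' : Integrable f' := f'.integrable
  have key : ∫⁻ z, ‖f (z + h) - f z‖ₑ ≤ ‖h‖ₑ * ∫⁻ z, ‖f' z‖ₑ := by
    have hpt : ∀ z, ‖f (z + h) - f z‖ₑ
        ≤ ∫⁻ t in Set.Ioc (0 : ℝ) 1, ‖f' (z + t • h)‖ₑ * ‖h‖ₑ := by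
      intro z
      have hd : ∀ t ∈ Set.uIcc (0 : ℝ) 1,
          HasDerivAt (fun t : ℝ => f (z + t • h)) (f' (z + t • h) h) t := by
        intro t _
        have h1 : HasDerivAt (fun t : ℝ => z + t • h) h t := by
          simpa using ((hasDerivAt_id t).smul_const h).const_add z
        exact (f.hasFDerivAt (z + t • h)).comp_hasDerivAt t h1
      have hc : Continuous fun t : ℝ => f' (z + t • h) h := by
        have := f'.continuous
        fun_prop
      have := intervalIntegral.integral_eq_sub_of_hasDerivAt hd (hc.intervalIntegrable 0 1)
      simp only [one_smul, zero_smul, add_zero] at this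
      rw [← this, intervalIntegral.integral_of_le zero_le_one]
      refine (enorm_integral_le_lintegral_enorm _).trans (lintegral_mono fun t => ?_)
      exact ContinuousLinearMap.le_opENorm _ _
    have hcont : Continuous fun p : Rd d × ℝ => f' (p.1 + p.2 • h) := by
      have := f'.continuous
      fun_prop
    calc ∫⁻ z, ‖f (z + h) - f z‖ₑ
        ≤ ∫⁻ z, ∫⁻ t in Set.Ioc (0 : ℝ) 1, ‖f' (z + t • h)‖ₑ * ‖h‖ₑ := lintegral_mono hpt
      _ = ∫⁻ t in Set.Ioc (0 : ℝ) 1, ∫⁻ z, ‖f' (z + t • h)‖ₑ * ‖h‖ₑ :=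
          lintegral_lintegral_swap (hcont.enorm.measurable.mul_const _).aemeasurable
      _ = ∫⁻ t in Set.Ioc (0 : ℝ) 1, (∫⁻ z, ‖f' z‖ₑ) * ‖h‖ₑ := by
          congr 1
          ext t
          rw [lintegral_mul_const' _ _ enorm_ne_top,
            lintegral_add_right_eq_self (fun z => ‖f' z‖ₑ) (t • h)]
      _ = ‖h‖ₑ * ∫⁻ z, ‖f' z‖ₑ := by simp [mul_comm]
  rw [← ofReal_integral_norm_eq_lintegral_enorm hi, ← ofReal_integral_norm_eq_lintegral_enorm hi',
    ← ofReal_norm, ← ENNReal.ofReal_mul (norm_nonneg _)] at key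
  exact (ENNReal.ofReal_le_ofReal_iff (by positivity)).1 key

/-- Rescaling reduces to the undilated kernel translated by `2^j (x' - x)`. -/
theorem SchwartzMap.integral_norm_fourier_dyadicDilate_sub_le (j : ℤ) (m : 𝓢(Rd d, ℂ))
    (x x' : Rd d) :
    ∫ y, ‖(𝓕 (m.dyadicDilate j) : 𝓢(Rd d, ℂ)) (y - x) - (𝓕 (m.dyadicDilate j) : 𝓢(Rd d, ℂ)) (y - x')‖
      ≤ (2 : ℝ) ^ j * ‖x - x'‖ * ∫ z, ‖fderivCLM ℝ (Rd d) ℂ (𝓕 m : 𝓢(Rd d, ℂ)) z‖ := by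
  set K : 𝓢(Rd d, ℂ) := 𝓕 m
  simp_rw [SchwartzMap.fourier_dyadicDilate_apply, ← smul_sub, norm_smul, smul_sub]
  rw [integral_const_mul, Measure.integral_comp_smul (volume : Measure (Rd d))
    (fun v => ‖K (v - (2 : ℝ) ^ j • x) - K (v - (2 : ℝ) ^ j • x')‖) ((2 : ℝ) ^ j),
    finrank_euclideanSpace_fin, smul_eq_mul,
    ← mul_assoc, Real.norm_of_nonneg (by positivity), abs_of_nonneg (by positivity),
    mul_inv_cancel₀ (by positivity), one_mul]
  set h := (2 : ℝ) ^ j • (x' - x) with hh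
  have hn : (2 : ℝ) ^ j * ‖x - x'‖ = ‖h‖ := by
    rw [hh, norm_smul, norm_sub_rev, Real.norm_of_nonneg (by positivity)]
  rw [hn]
  refine le_of_eq_of_le ?_ (K.integral_norm_sub_translate_le h)
  rw [← integral_sub_right_eq_self (fun z => ‖K (z + h) - K z‖) ((2 : ℝ) ^ j • x')]
  congr 1
  ext v
  rw [hh, smul_sub]
  congr 3
  abel_nf

/-- The pairing of a bounded function with the translates of a dilated kernel. -/
def kernelPairing (m : 𝓢(Rd d, ℂ)) (j : ℤ) (F : Rd d → ℂ) (x : Rd d) : ℂ :=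
  ∫ y, F y * (𝓕 (m.dyadicDilate j) : 𝓢(Rd d, ℂ)) (y - x)

/-- A common bound for the kernel of `m` and its gradient in `L¹`. -/
def kernelConst (m : 𝓢(Rd d, ℂ)) : ℝ :=
  (∫ x, ‖(𝓕 m : 𝓢(Rd d, ℂ)) x‖) + ∫ z, ‖fderivCLM ℝ (Rd d) ℂ (𝓕 m : 𝓢(Rd d, ℂ)) z‖

theorem kernelConst_nonneg (m : 𝓢(Rd d, ℂ)) : 0 ≤ kernelConst m := by
  unfold kernelConst; positivity

variable {F : Rd d → ℂ} {B : ℝ}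

theorem integrable_mul_translate (hF : AEStronglyMeasurable F) (hB : ∀ᵐ y, ‖F y‖ ≤ B)
    (K : 𝓢(Rd d, ℂ)) (x : Rd d) : Integrable fun y => F y * K (y - x) :=
  (K.integrable.comp_sub_right x).bdd_mul hF hB

theorem norm_kernelPairing_le (hB0 : 0 ≤ B) (hB : ∀ᵐ y, ‖F y‖ ≤ B)
    (m : 𝓢(Rd d, ℂ)) (j : ℤ) (x : Rd d) : ‖kernelPairing m j F x‖ ≤ kernelConst m * B := by
  set K : 𝓢(Rd d, ℂ) := 𝓕 (m.dyadicDilate j) with hK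
  calc ‖kernelPairing m j F x‖ ≤ ∫ y, B * ‖K (y - x)‖ := by
        refine norm_integral_le_of_norm_le ((K.integrable.comp_sub_right x).norm.const_mul B) ?_
        filter_upwards [hB] with y hy
        rw [norm_mul]
        gcongr
    _ = B * ∫ y, ‖(𝓕 m : 𝓢(Rd d, ℂ)) y‖ := by
        rw [integral_const_mul, integral_sub_right_eq_self (fun y => ‖K y‖) x, hK,
          SchwartzMap.integral_norm_fourier_dyadicDilate]
    _ ≤ B * kernelConst m := by
        gcongr
        exact le_add_of_nonneg_right (by positivity)
    _ = _ := mul_comm _ _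

theorem norm_kernelPairing_sub_le (hF : AEStronglyMeasurable F) (hB0 : 0 ≤ B)
    (hB : ∀ᵐ y, ‖F y‖ ≤ B) (m : 𝓢(Rd d, ℂ)) (j : ℤ) (x x' : Rd d) :
    ‖kernelPairing m j F x - kernelPairing m j F x'‖
      ≤ kernelConst m * B * ((2 : ℝ) ^ j * ‖x - x'‖) := by
  set K : 𝓢(Rd d, ℂ) := 𝓕 (m.dyadicDilate j) with hK
  calc ‖kernelPairing m j F x - kernelPairing m j F x'‖ ≤ ∫ y, B * ‖K (y - x) - K (y - x')‖ := by
        rw [kernelPairing, kernelPairing, ← integral_sub (integrable_mul_translate hF hB _ _)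
          (integrable_mul_translate hF hB _ _)]
        refine norm_integral_le_of_norm_le (((K.integrable.comp_sub_right x).sub
          (K.integrable.comp_sub_right x')).norm.const_mul B) ?_
        filter_upwards [hB] with y hy
        rw [← mul_sub, norm_mul]
        gcongr
    _ = B * ∫ y, ‖K (y - x) - K (y - x')‖ := integral_const_mul _ _
    _ ≤ B * ((2 : ℝ) ^ j * ‖x - x'‖ * kernelConst m) := by
        gcongr
        refine (SchwartzMap.integral_norm_fourier_dyadicDilate_sub_le j m x x').trans ?_
        gcongr
        exact le_add_of_nonneg_left (by positivity)
    _ = _ := by ring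

theorem continuous_kernelPairing (hF : AEStronglyMeasurable F) (hB0 : 0 ≤ B)
    (hB : ∀ᵐ y, ‖F y‖ ≤ B) (m : 𝓢(Rd d, ℂ)) (j : ℤ) : Continuous (kernelPairing m j F) := by
  refine (LipschitzWith.of_dist_le_mul (K := (kernelConst m * B * (2 : ℝ) ^ j).toNNReal)
    fun x x' => ?_).continuous
  have := kernelConst_nonneg m
  rw [Real.coe_toNNReal _ (by positivity), dist_eq_norm, dist_eq_norm, mul_assoc]
  exact norm_kernelPairing_sub_le hF hB0 hB m j x x'

theorem SchwartzMap.fourier_eq_fourierInv_neg (f : 𝓢(Rd d, ℂ)) (x : Rd d) :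
    (𝓕 f : 𝓢(Rd d, ℂ)) x = (𝓕⁻ f : 𝓢(Rd d, ℂ)) (-x) := by
  rw [fourier_coe, fourierInv_coe, Real.fourierInv_eq_fourier_neg, neg_neg]

theorem SchwartzMap.fourier_smulLeftCLM_fourierInv_apply (m h : 𝓢(Rd d, ℂ)) (y : Rd d) :
    (𝓕 (smulLeftCLM ℂ m (𝓕⁻ h : 𝓢(Rd d, ℂ))) : 𝓢(Rd d, ℂ)) y
      = ∫ x, (𝓕 m : 𝓢(Rd d, ℂ)) (y - x) * h x := by
  have e : smulLeftCLM ℂ m (𝓕⁻ h : 𝓢(Rd d, ℂ))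
      = 𝓕 (SchwartzMap.convolution (ContinuousLinearMap.mul ℂ ℂ) (𝓕⁻ m : 𝓢(Rd d, ℂ))
        (𝓕⁻ (𝓕⁻ h : 𝓢(Rd d, ℂ)) : 𝓢(Rd d, ℂ))) := by
    rw [SchwartzMap.fourier_convolution, fourier_fourierInv_eq, fourier_fourierInv_eq]
    ext x
    rw [smulLeftCLM_apply_apply m.hasTemperateGrowth]
    simp
  have hinv : ∀ x, (𝓕⁻ (𝓕⁻ h : 𝓢(Rd d, ℂ)) : 𝓢(Rd d, ℂ)) x = h (-x) := fun x => by
    have := SchwartzMap.fourier_eq_fourierInv_neg (𝓕⁻ h : 𝓢(Rd d, ℂ)) (-x)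
    rw [fourier_fourierInv_eq, neg_neg] at this
    exact this.symm
  rw [SchwartzMap.fourier_eq_fourierInv_neg, e, fourierInv_fourier_eq,
    SchwartzMap.convolution_apply, convolution_mul_swap, ← integral_neg_eq_self]
  congr 1
  ext x
  rw [hinv, neg_neg, SchwartzMap.fourier_eq_fourierInv_neg m]
  congr 2
  abel

/-- By Fubini the multiplier moves from the test function to the bounded function, where it acts as
integration against a translated kernel. -/
theorem integral_fourier_dilate_mul (hF : AEStronglyMeasurable F)
    (hB : ∀ᵐ y, ‖F y‖ ≤ B) (m : 𝓢(Rd d, ℂ)) (j : ℤ) (h : 𝓢(Rd d, ℂ)) :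
    ∫ y, (𝓕 (smulLeftCLM ℂ (m.dyadicDilate j) (𝓕⁻ h : 𝓢(Rd d, ℂ))) : 𝓢(Rd d, ℂ)) y * F y
      = ∫ x, h x * kernelPairing m j F x := by
  set K : 𝓢(Rd d, ℂ) := 𝓕 (m.dyadicDilate j) with hK
  have hint : Integrable (fun p : Rd d × Rd d => F p.1 * (h p.2 * K (p.1 - p.2)))
      (volume.prod volume) := by
    have h1 : Integrable (fun p : Rd d × Rd d => h p.2 * K (p.1 - p.2)) (volume.prod volume) :=
      h.integrable.convolution_integrand (ContinuousLinearMap.mul ℂ ℂ) K.integrable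
    exact h1.bdd_mul hF.comp_fst (Measure.quasiMeasurePreserving_fst.ae hB)
  calc _ = ∫ y, ∫ x, F y * (h x * K (y - x)) := by
        congr 1
        ext y
        rw [SchwartzMap.fourier_smulLeftCLM_fourierInv_apply, mul_comm, ← integral_const_mul]
        simp_rw [mul_comm (h _)]
        rfl
    _ = ∫ x, ∫ y, F y * (h x * K (y - x)) := integral_integral_swap hint
    _ = _ := by
        congr 1
        ext x
        rw [kernelPairing, ← integral_const_mul]
        congr 1
        ext y
        ring

end Kernel

/-! ### The space `Sdot` and functionals on it -/

section SdotLemmas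

variable {d : ℕ}

theorem mem_Sdot_iff (ψ : 𝓢(Rd d, ℂ)) :
    ψ ∈ Sdot d ↔ ∀ n : ℕ, iteratedFDeriv ℝ n (𝓕⁻ ψ : 𝓢(Rd d, ℂ)) 0 = 0 := by
  have e : ((𝓕 ψ : 𝓢(Rd d, ℂ)) : Rd d → ℂ)
      = fun x => (𝓕⁻ ψ : 𝓢(Rd d, ℂ)) ((-1 : ℝ) • x) := by
    ext x
    rw [SchwartzMap.fourier_eq_fourierInv_neg, neg_one_smul]
  change (∀ n : ℕ, iteratedFDeriv ℝ n (𝓕 ψ : 𝓢(Rd d, ℂ)) 0 = 0) ↔ _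
  refine forall_congr' fun n => ?_
  rw [e, iteratedFDeriv_comp_const_smul _ ((𝓕⁻ ψ : 𝓢(Rd d, ℂ)).smooth n)]
  simp

theorem fourier_mem_Sdot {g : 𝓢(Rd d, ℂ)} (hg : ∀ n : ℕ, iteratedFDeriv ℝ n g 0 = 0) :
    (𝓕 g : 𝓢(Rd d, ℂ)) ∈ Sdot d := by
  rw [mem_Sdot_iff, fourierInv_fourier_eq]
  exact hg

theorem hasSum_Sdot_iff {ι : Type*} {f : ι → Sdot d} {g : Sdot d} :
    HasSum f g ↔ HasSum (fun i => (f i : 𝓢(Rd d, ℂ))) g :=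
  (Topology.IsInducing.subtypeVal.hasSum_iff (g := (Sdot d).subtype) f g).symm

/-- Integration against a bounded continuous function, as a functional on Schwartz functions. -/
def boundedPairing (U : Rd d →ᵇ ℂ) : 𝓢(Rd d, ℂ) →L[ℂ] ℂ :=
  (ContinuousLinearMap.lsmul ℂ ℂ).flip.lpPairing volume ∞ 1
    ((memLp_top_of_bound U.continuous.aestronglyMeasurable ‖U‖
      (Filter.Eventually.of_forall U.norm_coe_le_norm)).toLp U) ∘L toLpCLM ℂ ℂ 1 volume

theorem boundedPairing_apply (U : Rd d →ᵇ ℂ) (ψ : 𝓢(Rd d, ℂ)) :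
    boundedPairing U ψ = ∫ x, ψ x * U x := by
  rw [boundedPairing, ContinuousLinearMap.comp_apply, ContinuousLinearMap.lpPairing_eq_integral]
  refine integral_congr_ae ?_
  filter_upwards [ψ.coeFn_toLp 1 volume, (memLp_top_of_bound U.continuous.aestronglyMeasurable ‖U‖
      (Filter.Eventually.of_forall U.norm_coe_le_norm)).coeFn_toLp] with x h1 h2
  rw [h2, toLpCLM_apply, h1]
  rfl

/-- A finite `L^∞` norm of a tempered distribution is attained. -/
theorem exists_eq_of_linftyNorm_lt_top {u : 𝓢'(Rd d, ℂ)} (hu : linftyNorm u < ⊤) :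
    ∃ F : Lp ℂ ∞ (volume : Measure (Rd d)), (F : 𝓢'(Rd d, ℂ)) = u ∧ ‖F‖ₑ = linftyNorm u := by
  simp only [linftyNorm, iInf_lt_iff] at hu
  obtain ⟨F, hF, -⟩ := hu
  refine ⟨F, hF, le_antisymm (le_iInf₂ fun F' hF' => ?_) (iInf₂_le F hF)⟩
  -- An `L^∞` function is determined by its distribution, so the infimum runs over a single element.
  have hinj : Function.Injective (Lp.toTemperedDistributionCLM ℂ (volume : Measure (Rd d)) ∞) :=
    LinearMap.ker_eq_bot.1 Lp.ker_toTemperedDistributionCLM_eq_bot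
  rw [hinj (a₁ := F) (a₂ := F') (hF.trans hF'.symm)]

/-- A bounded continuous function that annihilates `Sdot` is constant. -/
theorem eq_of_forall_integral_Sdot_eq_zero (U : Rd d →ᵇ ℂ)
    (hU : ∀ ψ : Sdot d, ∫ x, (ψ : 𝓢(Rd d, ℂ)) x * U x = 0) (x y : Rd d) : U x = U y := by
  let b : ContDiffBump (0 : Rd d) := ⟨1, 2, one_pos, one_lt_two⟩
  have hbc : HasCompactSupport fun ξ => (b ξ : ℂ) :=
    b.hasCompactSupport.comp_left (g := fun x : ℝ => (x : ℂ)) Complex.ofReal_zero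
  have hbs : ContDiff ℝ ∞ fun ξ => (b ξ : ℂ) := Complex.ofRealCLM.contDiff.comp b.contDiff
  set m : 𝓢(Rd d, ℂ) := hbc.toSchwartzMap hbs with hm
  have hm1 : ∀ᶠ ξ in nhds (0 : Rd d), m ξ = 1 := by
    filter_upwards [b.eventuallyEq_one] with ξ hξ
    change (b ξ : ℂ) = 1
    rw [hξ]
    simp
  have hUm : AEStronglyMeasurable U volume := U.continuous.aestronglyMeasurable
  have hUb : ∀ᵐ z, ‖U z‖ ≤ ‖U‖ := Filter.Eventually.of_forall U.norm_coe_le_norm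
  -- The dilated cutoff equals `1` near the origin, so removing this low-frequency part leaves a
  -- test function in `Sdot d`.
  have hmem : ∀ (j : ℤ) (h : 𝓢(Rd d, ℂ)),
      h - 𝓕 (smulLeftCLM ℂ (m.dyadicDilate j) (𝓕⁻ h : 𝓢(Rd d, ℂ))) ∈ Sdot d := by
    intro j h
    rw [mem_Sdot_iff]
    intro n
    have e : (𝓕⁻ (h - 𝓕 (smulLeftCLM ℂ (m.dyadicDilate j) (𝓕⁻ h : 𝓢(Rd d, ℂ)))) : 𝓢(Rd d, ℂ))
        = 𝓕⁻ h - smulLeftCLM ℂ (m.dyadicDilate j) (𝓕⁻ h : 𝓢(Rd d, ℂ)) := by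
      refine (map_sub (fourierInvCLM ℂ 𝓢(Rd d, ℂ)) _ _).trans ?_
      rw [fourierInvCLM_apply, fourierInvCLM_apply, fourierInv_fourier_eq]
    rw [e]
    have hev : ((𝓕⁻ h - smulLeftCLM ℂ (m.dyadicDilate j) (𝓕⁻ h : 𝓢(Rd d, ℂ)) : 𝓢(Rd d, ℂ)) :
        Rd d → ℂ) =ᶠ[nhds 0] fun _ => (0 : ℂ) := by
      have ht : Filter.Tendsto (fun ξ : Rd d => (2 : ℝ) ^ (-j) • ξ) (nhds 0) (nhds 0) := by
        have : Continuous fun ξ : Rd d => (2 : ℝ) ^ (-j) • ξ := continuous_const_smul _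
        simpa using this.tendsto 0
      filter_upwards [ht.eventually hm1] with ξ hξ
      rw [_root_.sub_apply, smulLeftCLM_apply_apply (m.dyadicDilate j).hasTemperateGrowth,
        SchwartzMap.dyadicDilate_apply, hξ, one_smul, sub_self]
    rw [(hev.iteratedFDeriv ℝ n).eq_of_nhds, iteratedFDeriv_fun_zero]
    rfl
  -- Since `U` annihilates `Sdot d`, it equals its own low-frequency part at every scale. Letting `j
  -- → -∞` then makes its Lipschitz constant tend to zero.
  have hW : ∀ j : ℤ, ⇑U = kernelPairing m j U := by
    intro j
    have hc := continuous_kernelPairing hUm (norm_nonneg U) hUb m j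
    refine (Continuous.ae_eq_iff_eq volume U.continuous hc).1 ?_
    have hl : LocallyIntegrable (fun z => U z - kernelPairing m j U z) volume :=
      (U.continuous.sub hc).locallyIntegrable
    have h0 := ae_eq_zero_of_integral_contDiff_smul_eq_zero hl fun g hg hgc => by
      have hc1 : HasCompactSupport fun ξ => (g ξ : ℂ) :=
        hgc.comp_left (g := fun x : ℝ => (x : ℂ)) Complex.ofReal_zero
      have hc2 : ContDiff ℝ ∞ fun ξ => (g ξ : ℂ) := Complex.ofRealCLM.contDiff.comp hg
      set h : 𝓢(Rd d, ℂ) := hc1.toSchwartzMap hc2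
      have h1 := hU ⟨_, hmem j h⟩
      have h2 := integral_fourier_dilate_mul hUm hUb m j h
      simp only [_root_.sub_apply, sub_mul] at h1
      have i1 : Integrable fun z => h z * U z := h.integrable.mul_bdd hUm hUb
      rw [integral_sub i1 ((SchwartzMap.integrable _).mul_bdd hUm hUb), h2, ← integral_sub i1
        (h.integrable.mul_bdd hc.aestronglyMeasurable (Filter.Eventually.of_forall
          (norm_kernelPairing_le (norm_nonneg U) hUb m j)))] at h1
      rw [← h1]
      congr 1
      ext z
      rw [Complex.real_smul, ← mul_sub]
      rfl
    filter_upwards [h0] with z hz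
    exact sub_eq_zero.1 hz
  have hle : ∀ n : ℕ, ‖U x - U y‖ ≤ kernelConst m * ‖U‖ * ((1 / 2 : ℝ) ^ n * ‖x - y‖) := by
    intro n
    have h := norm_kernelPairing_sub_le hUm (norm_nonneg U) hUb m (-(n : ℤ)) x y
    rw [← hW, zpow_neg, zpow_natCast, ← inv_pow, ← one_div] at h
    exact h
  have hlim : Filter.Tendsto (fun n : ℕ => kernelConst m * ‖U‖ * ((1 / 2 : ℝ) ^ n * ‖x - y‖))
      Filter.atTop (nhds 0) := by
    simpa using ((tendsto_pow_atTop_nhds_zero_of_lt_one (r := (1 / 2 : ℝ)) (by norm_num)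
      (by norm_num)).mul_const ‖x - y‖).const_mul (kernelConst m * ‖U‖)
  exact sub_eq_zero.1 (norm_le_zero_iff.1 (ge_of_tendsto' hlim hle))

end SdotLemmas

/-! ### Homogeneous symbols -/

section Symbols

variable {d : ℕ} {s : Rd d → ℂ}

/-- Cutting off a function that is smooth away from the origin gives a smooth function. -/
theorem contDiff_mul_ofReal_of_tsupport_subset (hs : ContDiffOn ℝ ∞ s {0}ᶜ) {θ : Rd d → ℝ}
    (hθ : ContDiff ℝ ∞ θ) (h0 : (0 : Rd d) ∉ tsupport θ) :
    ContDiff ℝ ∞ fun ξ => s ξ * (θ ξ : ℂ) := by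
  have hθ' : ContDiff ℝ ∞ fun ξ => (θ ξ : ℂ) := Complex.ofRealCLM.contDiff.comp hθ
  rw [contDiff_iff_contDiffAt]
  intro x
  by_cases hx : x ∈ tsupport θ
  · have hx0 : x ≠ 0 := fun h => h0 (h ▸ hx)
    exact (hs.contDiffAt (isOpen_compl_singleton.mem_nhds hx0)).mul hθ'.contDiffAt
  · have : (fun ξ => s ξ * (θ ξ : ℂ)) =ᶠ[nhds x] fun _ => 0 := by
      filter_upwards [notMem_tsupport_iff_eventuallyEq.1 hx] with ξ hξ
      simp [hξ]
    exact contDiffAt_const.congr_of_eventuallyEq this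

/-- A smooth cutoff to an annulus. -/
theorem exists_annulus_cutoff (d : ℕ) : ∃ θ : Rd d → ℝ, ContDiff ℝ ∞ θ ∧ HasCompactSupport θ ∧
    (0 : Rd d) ∉ tsupport θ ∧ ∀ ξ, 3 / 4 < ‖ξ‖ → ‖ξ‖ < 7 / 4 → θ ξ = 1 := by
  let b : ContDiffBump (0 : Rd d) := ⟨7 / 4, 2, by norm_num, by norm_num⟩
  let b' : ContDiffBump (0 : Rd d) := ⟨1 / 4, 1 / 2, by norm_num, by norm_num⟩
  refine ⟨fun ξ => b ξ - b' ξ, b.contDiff.sub b'.contDiff,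
    b.hasCompactSupport.sub b'.hasCompactSupport, ?_, fun ξ h1 h2 => ?_⟩
  · rw [notMem_tsupport_iff_eventuallyEq]
    filter_upwards [b.eventuallyEq_one, b'.eventuallyEq_one] with ξ h1 h2
    simp [h1, h2]
  · change b ξ - b' ξ = 1
    rw [b.one_of_mem_closedBall (by simpa using h2.le),
      b'.zero_of_le_dist (by
        change (1 / 2 : ℝ) ≤ _
        rw [dist_zero_right]
        linarith), sub_zero]

end Symbols

/-! ### Homogeneous Fourier multipliers on the Vishik-Besov intersection -/

section Multiplier

variable {d : ℕ} {s : Rd d → ℂ} {a : ℝ}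

/-- The transpose of a homogeneous Fourier multiplier, applied to `ψ ∈ Sdot d`, is the sum of its
dyadic pieces. -/
theorem exists_multiplier_transpose (φ : LittlewoodPaley d) (hs : ContDiffOn ℝ ∞ s {0}ᶜ)
    (hhom : ∀ (t : ℝ) (ξ : Rd d), 0 < t → ξ ≠ 0 → s (t • ξ) = ((t ^ a : ℝ) : ℂ) * s ξ) :
    ∃ M : 𝓢(Rd d, ℂ), ∀ ψ : Sdot d, ∃ χ : Sdot d,
      (∀ ξ, (𝓕⁻ (χ : 𝓢(Rd d, ℂ)) : 𝓢(Rd d, ℂ)) ξ = s ξ * (𝓕⁻ (ψ : 𝓢(Rd d, ℂ)) : 𝓢(Rd d, ℂ)) ξ) ∧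
      HasSum (fun j : ℤ => (((2 : ℝ) ^ ((j : ℝ) * a) : ℝ) : ℂ) • φ.blockTranspose j
        (𝓕 (smulLeftCLM ℂ (M.dyadicDilate j) (𝓕⁻ (ψ : 𝓢(Rd d, ℂ)) : 𝓢(Rd d, ℂ))))) χ := by
  obtain ⟨θ, hθ, hθc, hθ0, hθ1⟩ := exists_annulus_cutoff d
  have hφ0 : (0 : Rd d) ∉ tsupport φ.toFun := fun h => by
    have := (φ.support h).1
    rw [norm_zero] at this
    norm_num at this
  have hcs : ∀ {η : Rd d → ℝ}, HasCompactSupport η →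
      HasCompactSupport fun ξ => s ξ * (η ξ : ℂ) := fun h =>
    HasCompactSupport.mul_left (h.comp_left (g := fun x : ℝ => (x : ℂ)) Complex.ofReal_zero)
  let M : 𝓢(Rd d, ℂ) :=
    (hcs hθc).toSchwartzMap (contDiff_mul_ofReal_of_tsupport_subset hs hθ hθ0)
  let m : 𝓢(Rd d, ℂ) :=
    (hcs φ.compact).toSchwartzMap (contDiff_mul_ofReal_of_tsupport_subset hs φ.smooth hφ0)
  have hM : ∀ ξ, M ξ = s ξ * (θ ξ : ℂ) := fun _ => rfl
  have hm : ∀ ξ, m ξ = s ξ * (φ.toFun ξ : ℂ) := fun _ => rfl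
  -- The factor `φ` is supplied by the Littlewood-Paley block, so `M` only needs to agree with `s`
  -- where `φ` does not vanish.
  have hφM : ∀ ξ, (φ.toFun ξ : ℂ) * M ξ = m ξ := by
    intro ξ
    rw [hM, hm]
    by_cases h : φ.toFun ξ = 0
    · simp [h]
    · obtain ⟨h1, h2⟩ := φ.support (subset_tsupport _ h)
      rw [hθ1 ξ h1 h2]
      push_cast
      ring
  have hmsupp : tsupport m ⊆ {x | 1 / 2 ≤ ‖x‖ ∧ ‖x‖ ≤ 2} := by
    have h1 : tsupport m ⊆ tsupport φ.toFun := by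
      refine closure_mono fun ξ hξ h => hξ ?_
      rw [hm, h]
      simp
    intro ξ hξ
    obtain ⟨h2, h3⟩ := φ.support (h1 hξ)
    exact ⟨by linarith, by linarith⟩
  refine ⟨M, fun ψ => ?_⟩
  set g : 𝓢(Rd d, ℂ) := 𝓕⁻ (ψ : 𝓢(Rd d, ℂ)) with hg
  have hg0 : ∀ n, iteratedFDeriv ℝ n g 0 = 0 := (mem_Sdot_iff _).1 ψ.2
  let p : ℤ → 𝓢(Rd d, ℂ) := fun j =>
    ((2 : ℝ) ^ ((j : ℝ) * a)) • smulLeftCLM ℂ (m.dyadicDilate j) g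
  have hsum : ∀ k n, Summable fun j => SchwartzMap.seminorm ℝ k n (p j) :=
    SchwartzMap.summable_seminorm_smulLeftCLM_dyadicDilate m g hmsupp hg0 a
  set P := SchwartzMap.tsumOfSummable p hsum with hP
  have hp : ∀ j ξ, p j ξ = (((2 : ℝ) ^ ((j : ℝ) * a) : ℝ) : ℂ) * (m ((2 : ℝ) ^ (-j) • ξ) * g ξ) := by
    intro j ξ
    change (2 : ℝ) ^ ((j : ℝ) * a) • (smulLeftCLM ℂ (m.dyadicDilate j) g) ξ = _
    rw [smulLeftCLM_apply_apply (m.dyadicDilate j).hasTemperateGrowth, Complex.real_smul,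
      smul_eq_mul, SchwartzMap.dyadicDilate_apply]
  -- Homogeneity cancels the weight `2^{ja}`, so the pieces sum to `s g` by the partition of unity.
  have hp' : ∀ j ξ, ξ ≠ 0 → p j ξ = (φ.toFun ((2 : ℝ) ^ (-j) • ξ) : ℂ) * (s ξ * g ξ) := by
    intro j ξ hξ
    rw [hp, hm, hhom _ _ (by positivity) hξ, ← Real.rpow_intCast, ← Real.rpow_mul two_pos.le]
    have : (((2 : ℝ) ^ ((j : ℝ) * a) : ℝ) : ℂ) * (((2 : ℝ) ^ (((-j : ℤ) : ℝ) * a) : ℝ) : ℂ) = 1 := by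
      rw [← Complex.ofReal_mul, ← Real.rpow_add two_pos]
      simp
    linear_combination s ξ * (φ.toFun ((2 : ℝ) ^ (((-j : ℤ)) : ℝ) • ξ) : ℂ) * g ξ * this
  have hpflat : ∀ j n, iteratedFDeriv ℝ n (p j) 0 = 0 := by
    intro j n
    have ht : Filter.Tendsto (fun ξ : Rd d => (2 : ℝ) ^ (-j) • ξ) (nhds 0) (nhds 0) := by
      have : Continuous fun ξ : Rd d => (2 : ℝ) ^ (-j) • ξ := continuous_const_smul _
      simpa using this.tendsto 0
    have hev : ⇑(p j) =ᶠ[nhds 0] fun _ => (0 : ℂ) := by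
      filter_upwards [ht.eventually (notMem_tsupport_iff_eventuallyEq.1 hφ0)] with ξ hξ
      rw [hp, hm, hξ]
      simp
    rw [(hev.iteratedFDeriv ℝ n).eq_of_nhds, iteratedFDeriv_fun_zero]
    rfl
  have hPflat : ∀ n, iteratedFDeriv ℝ n P 0 = 0 := by
    intro n
    rw [hP, SchwartzMap.iteratedFDeriv_tsumOfSummable]
    simp [hpflat]
  have hPs : ∀ ξ, P ξ = s ξ * g ξ := by
    intro ξ
    rw [hP, SchwartzMap.tsumOfSummable_apply]
    -- The value `s 0` is arbitrary; both sides vanish at the origin by flatness.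
    by_cases hξ : ξ = 0
    · subst hξ
      have hz : ∀ h : 𝓢(Rd d, ℂ), (∀ n, iteratedFDeriv ℝ n h 0 = 0) → h 0 = 0 := fun h hh => by
        rw [← norm_eq_zero, ← norm_iteratedFDeriv_zero (𝕜 := ℝ), hh 0, norm_zero]
      simp [hz _ (hpflat _), hz g hg0]
    · simp_rw [hp' _ ξ hξ]
      rw [tsum_mul_right]
      have h1 := Complex.hasSum_ofReal.2 (φ.sum_eq_one ξ hξ)
      rw [h1.tsum_eq]
      simp
  refine ⟨⟨𝓕 P, fourier_mem_Sdot hPflat⟩, fun ξ => ?_, ?_⟩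
  · change (𝓕⁻ (𝓕 P : 𝓢(Rd d, ℂ)) : 𝓢(Rd d, ℂ)) ξ = _
    rw [fourierInv_fourier_eq, hPs]
  · rw [hasSum_Sdot_iff]
    have h := (SchwartzMap.hasSum_tsumOfSummable p hsum).mapL (fourierCLM ℂ 𝓢(Rd d, ℂ))
    refine h.congr_fun fun j => ?_
    change (((2 : ℝ) ^ ((j : ℝ) * a) : ℝ) : ℂ) • 𝓕 (smulLeftCLM ℂ (φ.symbol j) (𝓕⁻
        (𝓕 (smulLeftCLM ℂ (M.dyadicDilate j) g) : 𝓢(Rd d, ℂ)))) = 𝓕 (p j)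
    rw [fourierInv_fourier_eq, ← FourierTransform.fourier_smul]
    congr 1
    ext ξ
    rw [hp, _root_.smul_apply, smulLeftCLM_apply_apply (φ.symbol_hasTemperateGrowth j),
      smulLeftCLM_apply_apply (M.dyadicDilate j).hasTemperateGrowth, SchwartzMap.dyadicDilate_apply,
      ← hφM, smul_eq_mul, smul_eq_mul, smul_eq_mul, LittlewoodPaley.symbol, mul_assoc (φ.toFun _ : ℂ)]

theorem two_rpow_eq_ofReal (t : ℝ) : (2 : ℝ≥0∞) ^ t = ENNReal.ofReal ((2 : ℝ) ^ t) := by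
  rw [← ENNReal.ofReal_rpow_of_pos two_pos, ENNReal.ofReal_ofNat]

theorem block_linftyNorm_lt_top {φ : LittlewoodPaley d} {a : ℝ} {w : SdotDual d}
    (h : besovNorm φ a w < ⊤) (j : ℤ) : linftyNorm (φ.block j w) < ⊤ := by
  have h1 := ENNReal.ne_top_of_tsum_ne_top h.ne j
  refine lt_top_iff_ne_top.2 fun h2 => h1 ?_
  rw [h2, ENNReal.mul_top]
  rw [two_rpow_eq_ofReal]
  exact (ENNReal.ofReal_pos.2 (by positivity)).ne'

theorem vishik_sum_le {φ : LittlewoodPaley d} {β : ℝ} {G : ℝ → ℝ} (hG : ∀ n : ℕ, 0 < G n)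
    (w : SdotDual d) (N : ℕ) :
    ∑' j : Set.Iic (N : ℤ), (2 : ℝ≥0∞) ^ (((j : ℤ) : ℝ) * β) * linftyNorm (φ.block j w)
      ≤ vishikNorm φ β G w * ENNReal.ofReal (G N) := by
  rw [← ENNReal.div_le_iff (ENNReal.ofReal_pos.2 (hG N)).ne' ENNReal.ofReal_ne_top]
  exact le_iSup (fun N : ℕ => (∑' j : Set.Iic (N : ℤ),
    (2 : ℝ≥0∞) ^ (((j : ℤ) : ℝ) * β) * linftyNorm (φ.block j w)) / ENNReal.ofReal (G N)) N

/-- A Fourier multiplier that is homogeneous of degree `β - 1` maps distributions with finite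
Vishik and Besov norms to bounded continuous functions with a controlled modulus of continuity. -/
theorem exists_bounded_multiplier_image (β : ℝ) (φ : LittlewoodPaley d) {G : ℝ → ℝ}
    (hG : IsGrowth 1 G) (hs : ContDiffOn ℝ ∞ s {0}ᶜ)
    (hhom : ∀ (t : ℝ) (ξ : Rd d), 0 < t → ξ ≠ 0 →
      s (t • ξ) = ((t ^ (β - 1) : ℝ) : ℂ) * s ξ) :
    ∃ C : ℝ, ∀ w : SdotDual d, vishikNorm φ β G w < ⊤ → besovNorm φ (β - 1) w < ⊤ →
      ∃ (u : Rd d →ᵇ ℂ) (v : SdotDual d), IsMultiplierImage s w v ∧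
        (∀ ψ : Sdot d, v ψ = ∫ x, (ψ : 𝓢(Rd d, ℂ)) x * u x) ∧
        ∀ x y : Rd d, x ≠ y → ‖u x - u y‖ ≤
          C * (‖x - y‖ * yudovich G (1 / ‖x - y‖) * (vishikBesovNorm φ β 1 G w).toReal) := by
  obtain ⟨M, hM⟩ := exists_multiplier_transpose φ hs hhom
  obtain ⟨C, hC, hCle⟩ := hG.exists_dyadic_sum_le β
  have hc0 := kernelConst_nonneg M
  refine ⟨2 * kernelConst M * C.toReal, fun w hV hB => ?_⟩
  choose F hF hFn using fun j => exists_eq_of_linftyNorm_lt_top (block_linftyNorm_lt_top hB j)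
  have hFm : ∀ j, AEStronglyMeasurable (F j) volume := fun j => Lp.aestronglyMeasurable (F j)
  have hFb : ∀ j, ∀ᵐ y, ‖F j y‖ ≤ ‖F j‖ := fun j => by
    filter_upwards [ae_le_eLpNormEssSup (f := F j) (μ := volume)] with y hy
    rw [Lp.norm_def, ← toReal_enorm]
    refine ENNReal.toReal_mono (Lp.eLpNorm_ne_top _) ?_
    rwa [eLpNorm_exponent_top]
  set W : ℤ → Rd d → ℂ := fun j => kernelPairing M j (F j) with hW
  set A : ℤ → ℝ := fun j => (2 : ℝ) ^ ((j : ℝ) * (β - 1)) with hA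
  have hA0 : ∀ j, 0 ≤ A j := fun j => by positivity
  have hterm : ∀ j : ℤ, (2 : ℝ≥0∞) ^ ((j : ℝ) * (β - 1)) * linftyNorm (φ.block j w)
      = ENNReal.ofReal (A j * ‖F j‖) := fun j => by
    rw [← hFn, two_rpow_eq_ofReal, ENNReal.ofReal_mul (hA0 j), ofReal_norm]
  have hsumB : Summable fun j => A j * ‖F j‖ := by
    have h : ∑' j, ENNReal.ofReal (A j * ‖F j‖) ≠ ⊤ := by
      simp_rw [← hterm]
      exact hB.ne
    refine (ENNReal.summable_toReal h).congr fun j => ?_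
    rw [ENNReal.toReal_ofReal (mul_nonneg (hA0 j) (norm_nonneg _))]
  have hbound : ∀ j x, ‖((A j : ℝ) : ℂ) * W j x‖ ≤ kernelConst M * (A j * ‖F j‖) := by
    intro j x
    rw [norm_mul, Complex.norm_real, Real.norm_of_nonneg (hA0 j)]
    calc A j * ‖W j x‖ ≤ A j * (kernelConst M * ‖F j‖) :=
          mul_le_mul_of_nonneg_left (norm_kernelPairing_le (norm_nonneg _) (hFb j) M j x) (hA0 j)
      _ = _ := by ring
  have hWc : ∀ j, Continuous (W j) := fun j =>
    continuous_kernelPairing (hFm j) (norm_nonneg _) (hFb j) M j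
  have hsumK : Summable fun j => kernelConst M * (A j * ‖F j‖) := hsumB.mul_left _
  have hsumW : ∀ x, Summable fun j => ((A j : ℝ) : ℂ) * W j x := fun x =>
    hsumK.of_norm_bounded fun j => hbound j x
  let u : Rd d →ᵇ ℂ := BoundedContinuousFunction.ofNormedAddCommGroup
    (fun x => ∑' j, ((A j : ℝ) : ℂ) * W j x)
    (continuous_tsum (fun j => continuous_const.mul (hWc j)) hsumK hbound)
    (∑' j, kernelConst M * (A j * ‖F j‖))
    fun x => tsum_of_norm_bounded hsumK.hasSum fun j => hbound j x
  have hu : ∀ x, u x = ∑' j, ((A j : ℝ) : ℂ) * W j x := fun _ => rfl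
  refine ⟨u, boundedPairing u ∘L (Sdot d).subtypeL, fun ψ => ?_,
    fun ψ => boundedPairing_apply u ψ, fun x y hxy => ?_⟩
  · obtain ⟨χ, hχ, hχs⟩ := hM ψ
    refine ⟨χ, hχ, ?_⟩
    change boundedPairing u ψ = w χ
    rw [boundedPairing_apply]
    have h1 := hχs.mapL w
    -- Composed with the block transpose, `w` is the `j`-th block, hence integration against `F j`,
    -- onto which the kernel is moved.
    have hw : ∀ j : ℤ, w ((((2 : ℝ) ^ ((j : ℝ) * (β - 1)) : ℝ) : ℂ) • φ.blockTranspose j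
        (𝓕 (smulLeftCLM ℂ (M.dyadicDilate j) (𝓕⁻ (ψ : 𝓢(Rd d, ℂ)) : 𝓢(Rd d, ℂ)))))
        = ∫ x, (ψ : 𝓢(Rd d, ℂ)) x * (((A j : ℝ) : ℂ) * W j x) := by
      intro j
      rw [map_smul, smul_eq_mul]
      change _ * φ.block j w _ = _
      rw [← hF j, Lp.toTemperedDistribution_apply]
      simp_rw [smul_eq_mul]
      rw [integral_fourier_dilate_mul (hFm j) (hFb j), ← integral_const_mul]
      congr 1
      ext x
      ring
    simp_rw [hw] at h1
    have hψ := (ψ : 𝓢(Rd d, ℂ)).integrable (μ := volume)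
    have h2 := hasSum_integral_of_summable_integral_norm (μ := volume)
      (F := fun j x => (ψ : 𝓢(Rd d, ℂ)) x * (((A j : ℝ) : ℂ) * W j x))
      (fun j => hψ.mul_bdd (continuous_const.mul (hWc j)).aestronglyMeasurable
        (Filter.Eventually.of_forall (hbound j))) (by
        refine (hsumK.mul_left (∫ x, ‖(ψ : 𝓢(Rd d, ℂ)) x‖)).of_nonneg_of_le
          (fun j => by positivity) fun j => ?_
        rw [← integral_mul_const]
        refine integral_mono_of_nonneg (Filter.Eventually.of_forall fun x => norm_nonneg _)
          (hψ.norm.mul_const _) (Filter.Eventually.of_forall fun x => ?_)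
        change ‖(ψ : 𝓢(Rd d, ℂ)) x * (((A j : ℝ) : ℂ) * W j x)‖ ≤ _
        rw [norm_mul]
        exact mul_le_mul_of_nonneg_left (hbound j x) (norm_nonneg _))
    rw [← h2.unique h1]
    congr 1
    ext x
    rw [hu, tsum_mul_left]
  · set r := ‖x - y‖ with hr
    have hr0 : 0 < r := norm_pos_iff.2 (sub_ne_zero.2 hxy)
    set X := vishikBesovNorm φ β 1 G w with hX
    have hXt : X ≠ ⊤ := (max_lt hV hB).ne
    have hVX : vishikNorm φ β G w ≤ X := le_max_left _ _
    have hBX : besovNorm φ (β - 1) w ≤ X := le_max_right _ _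
    have hmain := hCle (fun j => linftyNorm (φ.block j w)) X
      (fun N => (vishik_sum_le (fun n => hG.pos _ n.cast_nonneg) w N).trans (by gcongr)) hBX r hr0
    -- The sup bound at both points (hence the factor `2`) and the Lipschitz bound combine into the
    -- minimum.
    have hj : ∀ j : ℤ, ‖((A j : ℝ) : ℂ) * W j x - ((A j : ℝ) : ℂ) * W j y‖ₑ
        ≤ ENNReal.ofReal (2 * kernelConst M) * ((2 : ℝ≥0∞) ^ ((j : ℝ) * (β - 1)) *
          linftyNorm (φ.block j w) * min 1 ((2 : ℝ≥0∞) ^ (j : ℝ) * ENNReal.ofReal r)) := by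
      intro j
      have h2 : ‖W j x - W j y‖ ≤ 2 * kernelConst M * (‖F j‖ * min 1 ((2 : ℝ) ^ (j : ℝ) * r)) := by
        have hx := norm_kernelPairing_le (norm_nonneg _) (hFb j) M j x
        have hy := norm_kernelPairing_le (norm_nonneg _) (hFb j) M j y
        have hd := norm_kernelPairing_sub_le (hFm j) (norm_nonneg _) (hFb j) M j x y
        have hk : 0 ≤ kernelConst M * ‖F j‖ := by positivity
        rcases min_cases (1 : ℝ) ((2 : ℝ) ^ (j : ℝ) * r) with ⟨h, -⟩ | ⟨h, -⟩
        · rw [h]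
          have := norm_sub_le (W j x) (W j y)
          linarith
        · rw [h, Real.rpow_intCast]
          have : 0 ≤ kernelConst M * ‖F j‖ * ((2 : ℝ) ^ j * r) := by positivity
          change ‖W j x - W j y‖ ≤ _ at hd
          linarith
      have hmin : min 1 ((2 : ℝ≥0∞) ^ (j : ℝ) * ENNReal.ofReal r)
          = ENNReal.ofReal (min 1 ((2 : ℝ) ^ (j : ℝ) * r)) := by
        rw [two_rpow_eq_ofReal, ← ENNReal.ofReal_mul (by positivity), ← ENNReal.ofReal_one]
        exact (ENNReal.ofReal_mono.map_min).symm
      rw [hterm, hmin, ← ENNReal.ofReal_mul (mul_nonneg (hA0 j) (norm_nonneg _)),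
        ← ENNReal.ofReal_mul (by positivity), ← mul_sub, ← ofReal_norm, norm_mul,
        Complex.norm_real, Real.norm_of_nonneg (hA0 j)]
      refine ENNReal.ofReal_le_ofReal ?_
      calc A j * ‖W j x - W j y‖
          ≤ A j * (2 * kernelConst M * (‖F j‖ * min 1 ((2 : ℝ) ^ (j : ℝ) * r))) :=
            mul_le_mul_of_nonneg_left h2 (hA0 j)
        _ = _ := by ring
    have hfin : ‖u x - u y‖ₑ ≤ ENNReal.ofReal (2 * kernelConst M) *
        (C * (ENNReal.ofReal (r * yudovich G (1 / r)) * X)) := by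
      rw [hu, hu, ← (hsumW x).tsum_sub (hsumW y)]
      refine enorm_tsum_le_tsum_enorm.trans ((ENNReal.tsum_le_tsum hj).trans ?_)
      rw [ENNReal.tsum_mul_left]
      gcongr
    have hy0 : 0 ≤ r * yudovich G (1 / r) := mul_nonneg hr0.le (hG.yudovich_nonneg (by positivity))
    have := ENNReal.toReal_mono (by finiteness) hfin
    rw [toReal_enorm, ENNReal.toReal_mul, ENNReal.toReal_mul, ENNReal.toReal_mul,
      ENNReal.toReal_ofReal (by positivity), ENNReal.toReal_ofReal hy0] at this
    linarith

end Multiplier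

/-! ### The Biot-Savart symbol and passage from components to vector fields -/

theorem velocitySymbol_contDiffOn {d : ℕ} (R : RieszType d) (β : ℝ) (l : Fin d) :
    ContDiffOn ℝ ∞ (velocitySymbol R β l) {0}ᶜ := by
  refine (R.smooth l).mul (Complex.ofRealCLM.contDiff.comp_contDiffOn fun ξ hξ => ?_)
  have hn : ‖ξ‖ ≠ 0 := norm_ne_zero_iff.2 hξ
  exact ((contDiffAt_const.mul (contDiffAt_norm ℝ hξ)).rpow_const_of_ne
    (by positivity)).contDiffWithinAt

theorem velocitySymbol_smul {d : ℕ} (R : RieszType d) (β : ℝ) (l : Fin d) (t : ℝ) (ξ : Rd d)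
    (ht : 0 < t) (hξ : ξ ≠ 0) :
    velocitySymbol R β l (t • ξ) = ((t ^ (β - 1) : ℝ) : ℂ) * velocitySymbol R β l ξ := by
  rw [velocitySymbol, velocitySymbol, R.homogeneous l t ξ ht hξ, norm_smul,
    Real.norm_of_nonneg ht.le]
  have : 2 * Real.pi * (t * ‖ξ‖) = t * (2 * Real.pi * ‖ξ‖) := by ring
  rw [this, Real.mul_rpow ht.le (by positivity)]
  push_cast
  ring

/-- The transposed test function is determined by its inverse Fourier transform. This identifies the
velocity functional of an arbitrary representative with the constructed one. -/
theorem IsMultiplierImage.unique {d : ℕ} {σ : Rd d → ℂ} {f w w' : SdotDual d}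
    (h : IsMultiplierImage σ f w) (h' : IsMultiplierImage σ f w') : w = w' := by
  ext ψ
  obtain ⟨χ, hχ, hw⟩ := h ψ
  obtain ⟨χ', hχ', hw'⟩ := h' ψ
  have e : (𝓕⁻ (χ : 𝓢(Rd d, ℂ)) : 𝓢(Rd d, ℂ)) = 𝓕⁻ (χ' : 𝓢(Rd d, ℂ)) := by
    ext ξ
    rw [hχ, hχ']
  have e' : χ = χ' := by
    have := congrArg (fun g : 𝓢(Rd d, ℂ) => (𝓕 g : 𝓢(Rd d, ℂ))) e
    simp only [fourier_fourierInv_eq] at this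
    exact Subtype.ext this
  rw [hw, hw', e']

theorem EuclideanSpace.norm_le_sum_norm {d : ℕ} (z : EuclideanSpace ℂ (Fin d)) :
    ‖z‖ ≤ ∑ l, ‖z l‖ := by
  rw [EuclideanSpace.norm_eq]
  refine Real.sqrt_le_iff.2 ⟨Finset.sum_nonneg fun _ _ => norm_nonneg _, ?_⟩
  exact Finset.sum_sq_le_sq_sum_of_nonneg fun _ _ => norm_nonneg _

/-- A coordinate of a bounded continuous vector field. -/
def coordBCF {d : ℕ} (V : Rd d →ᵇ EuclideanSpace ℂ (Fin d)) (l : Fin d) : Rd d →ᵇ ℂ :=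
  BoundedContinuousFunction.ofNormedAddCommGroup (fun x => V x l) (by fun_prop) ‖V‖
    fun x => (PiLp.norm_apply_le (V x) l).trans (V.norm_coe_le_norm x)

/-- The bounded continuous vector field with given coordinates. -/
def vectorBCF {d : ℕ} (u : Fin d → (Rd d →ᵇ ℂ)) : Rd d →ᵇ EuclideanSpace ℂ (Fin d) :=
  BoundedContinuousFunction.ofNormedAddCommGroup (fun x => WithLp.toLp 2 fun l => u l x)
    (by fun_prop) (∑ l, ‖u l‖) fun x => (EuclideanSpace.norm_le_sum_norm _).trans
      (Finset.sum_le_sum fun l _ => (u l).norm_coe_le_norm x)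

end

theorem theorem3p3 (d : ℕ) (β : ℝ) (φ : LittlewoodPaley d) (R : RieszType d)
    (G : ℝ → ℝ) (hG : IsGrowth 1 G) :
    ∃ C : ℝ, ∀ w : SdotDual d,
      vishikNorm φ β G w < ⊤ → besovNorm φ (β - 1) w < ⊤ →
        (∃ V, IsVelocity R β w V) ∧
          ∀ V, IsVelocity R β w V → ∀ x y : Rd d, x ≠ y →
            ‖V x - V y‖ ≤
              C * ‖x - y‖ * yudovich G (1 / ‖x - y‖) * (vishikBesovNorm φ β 1 G w).toReal := by
  choose C hC using fun l => exists_bounded_multiplier_image β φ hG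
    (velocitySymbol_contDiffOn R β l) (velocitySymbol_smul R β l)
  refine ⟨∑ l, C l, fun w hV hB => ?_⟩
  choose u v hv hvu hu using fun l => hC l w hV hB
  refine ⟨⟨vectorBCF u, v, hv, hvu⟩, ?_⟩
  rintro V ⟨v', hv', hvV⟩ x y hxy
  -- Each coordinate of `V` differs from the constructed function by a constant, which drops out of
  -- increments.
  have hcoord : ∀ l, V x l - V y l = u l x - u l y := by
    intro l
    have h := eq_of_forall_integral_Sdot_eq_zero (coordBCF V l - u l) (fun ψ => by
      have h1 : ∫ x, (ψ : 𝓢(Rd d, ℂ)) x * V x l = ∫ x, (ψ : 𝓢(Rd d, ℂ)) x * u l x := by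
        rw [← hvV, ← hvu, (hv' l).unique (hv l)]
      have hi : ∀ U : Rd d →ᵇ ℂ, Integrable fun x => (ψ : 𝓢(Rd d, ℂ)) x * U x := fun U =>
        (ψ : 𝓢(Rd d, ℂ)).integrable.mul_bdd U.continuous.aestronglyMeasurable
          (Filter.Eventually.of_forall U.norm_coe_le_norm)
      calc _ = ∫ x, ((ψ : 𝓢(Rd d, ℂ)) x * coordBCF V l x - (ψ : 𝓢(Rd d, ℂ)) x * u l x) := by
            congr 1
            ext x
            rw [← mul_sub]
            rfl
        _ = 0 := by
            rw [integral_sub (hi _) (hi _), sub_eq_zero]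
            exact h1) x y
    have h' : V x l - u l x = V y l - u l y := h
    linear_combination h'
  calc ‖V x - V y‖ ≤ ∑ l, ‖(V x - V y) l‖ := EuclideanSpace.norm_le_sum_norm _
    _ ≤ ∑ l, C l * (‖x - y‖ * yudovich G (1 / ‖x - y‖) * (vishikBesovNorm φ β 1 G w).toReal) := by
        refine Finset.sum_le_sum fun l _ => ?_
        rw [PiLp.sub_apply, hcoord]
        exact hu l x y hxy
    _ = _ := by rw [← Finset.sum_mul]; ring
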